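/- Let $d\ge 2$, let $X$ be a random vector in $\mathbb R^d$ whose distribution has a density $p\ge 0$, let $\mathbb X=\operatorname{supp}p$ (the closure of $\{p\ne 0\}$) be compact, let $p$ be smooth ($C^\infty$) on $\mathbb X$, and let $p>0$ on the interior of $\mathbb X$. (This allows $p$ to be smooth on all of $\mathbb R^d$, and also to jump to $0$ across $\partial\mathbb X$, as for uniform distributions.) Let $\ell>0$ and let $\Gamma:[0,\ell]\to\mathbb X$ be a $C^\infty$ curve parametrized by arc length with $\Gamma(s)\neq\Gamma(t)$ for $s\ne t$ in $[0,\ell]$. For $x\in\mathbb R^d$ let $\lambda(x)$ be the largest $s\in[0,\ell]$ with $\|x-\Gamma(s)\|=\min_{t\in[0,\ell]}\|x-\Gamma(t)\|$, let $\pi(x)=\Gamma(\lambda(x))$, and let $\mathcal A$ be the set of points $x$ that have more than one closest point on $\Gamma$. The curve $\Gamma$ is called self-consistent for $X$ (a principal curve of $X$) if $\mathbb E[X\mid\lambda(X)=s]=\Gamma(s)$ for almost every $s$ with respect to the distribution of $\lambda(X)$. Let $T=\Gamma'$ and let $T,N_1,\dots,N_{d-1}$ be any smooth moving orthonormal frame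 along $\Gamma$, with principal curvatures $\kappa_i(s)=\langle T'(s),N_i(s)\rangle$ and $\kappa=(\kappa_1,\dots,\kappa_{d-1})^{\mathrm T}$. Put $\nu(s,u)=\Gamma(s)+\sum_{i=1}^{d-1}u_iN_i(s)$ for $s\in[0,\ell]$, $u\in\mathbb R^{d-1}$, and $$m(x)=\bigl(\lambda(x),\langle x-\pi(x),N_1(\lambda(x))\rangle,\dots,\langle x-\pi(x),N_{d-1}(\lambda(x))\rangle\bigr).$$ Assume that $\nu$ is a diffeomorphism on $\mathbb X\setminus\mathcal A$ in the sense that $\nu(m(x))=x$ for all $x\in\mathbb X\setminus\mathcal A$, that $m$ is differentiable on $\mathbb X\setminus\mathcal A$, and that $\nu$ is differentiable on $m(\mathbb X\setminus\mathcal A)$. For $s\in[0,\ell]$ let $\mathcal R(s)=\{u\in\mathbb R^{d-1}:\lambda(\nu(s,u))=s,\ \nu(s,u)\notin\mathcal A\}$, and for a multi-index $j\in\mathbb N_0^{d-1}$ define the transverse moment $$\mu_j(s)=\int_{\mathcal R(s)}u_1^{j_1}\cdots u_{d-1}^{j_{d-1}}\,p(\nu(s,u))\,du .$$ Let $\mu(s)=(\mu_{e_i}(s))_{i=1}^{d-1}$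 and $G(s)=(\mu_{e_i+e_k}(s))_{i,k=1}^{d-1}$, where $e_1,\dots,e_{d-1}$ is the canonical basis. Then: 1. If $p$ is continuous on $\mathbb R^d$ (in particular, if it is smooth on $\mathbb R^d$), then $\Gamma$ is self-consistent for $X$ if and only if $\mu(s)=G(s)\,\kappa(s)$ for every $s\in[0,\ell]$. Without this continuity, $\Gamma$ is self-consistent for $X$ if and only if $\mu(s)=G(s)\,\kappa(s)$ for Lebesgue-almost every $s\in[0,\ell]$. 2. The Gram matrix $G(s)$ is invertible for every $s\in[0,\ell]$ such that $\Gamma(s)$ lies in the interior of $\mathbb X$ or $\mu_0(s)\neq 0$, where $\mu_0(s)=\int_{\mathcal R(s)}p(\nu(s,u))\,du$. 3. Consequently, if $p$ is continuous on $\mathbb R^d$, then $\Gamma$ is self-consistent for $X$ if and only if $\kappa(s)=G(s)^{-1}\mu(s)$ for every $s\in[0,\ell]$ with $\mu_0(s)\ne 0$. Without this continuity, $\Gamma$ is self-consistent for $X$ if and only if $\kappa(s)=G(s)^{-1}\mu(s)$ for almost every $s\in[0,\ell]$ with $\mu_0(s)\ne0$. -/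

import Mathlib

open MeasureTheory Set
open scoped ContDiff

namespace PrincipalCurve

/-- The Euclidean space `ℝ^d`. -/
abbrev E (d : ℕ) : Type := EuclideanSpace ℝ (Fin d)

noncomputable section

/-! ### Curves, distance, projection -/

/-- The tangent `T = Γ'` of a curve on `[0, ℓ]` (one-sided at the endpoints). -/
def tangent {d : ℕ} (Γ : ℝ → E d) (ℓ : ℝ) (s : ℝ) : E d :=
  derivWithin Γ (Icc 0 ℓ) s

/-- `Γ : [0, ℓ] → ℝ^d` is a smooth curve without self-intersections, i.e. `Γ s₁ ≠ Γ s₂` for all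
`s₁ ≠ s₂` in `[0, ℓ]`, parametrized by arc-length. The values of `Γ` outside `[0, ℓ]` play no
role. -/
structure IsSmoothJordanCurve {d : ℕ} (Γ : ℝ → E d) (ℓ : ℝ) : Prop where
  length_pos : 0 < ℓ
  smooth : ContDiffOn ℝ ∞ Γ (Icc 0 ℓ)
  injOn : InjOn Γ (Icc 0 ℓ)
  arcLength : ∀ s ∈ Icc 0 ℓ, ‖tangent Γ ℓ s‖ = 1

/-- The parameters `s ∈ [0, ℓ]` for which `Γ s` is a point of the curve closest to `x`. -/
def closestParams {d : ℕ} (Γ : ℝ → E d) (ℓ : ℝ) (x : E d) : Set ℝ :=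
  {s | s ∈ Icc 0 ℓ ∧ ‖x - Γ s‖ = Metric.infDist x (Γ '' Icc 0 ℓ)}

/-- The set `𝒜_Γ` of ambiguity points: the points with several closest points on the curve. -/
def ambiguitySet {d : ℕ} (Γ : ℝ → E d) (ℓ : ℝ) : Set (E d) :=
  {x | ∃ s ∈ closestParams Γ ℓ x, ∃ t ∈ closestParams Γ ℓ x, Γ s ≠ Γ t}

/-- The projection index `λ_Γ(x)`: the largest parameter of a closest point. -/
def projIndex {d : ℕ} (Γ : ℝ → E d) (ℓ : ℝ) (x : E d) : ℝ :=
  sSup (closestParams Γ ℓ x)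

/-- The projection `π_Γ = Γ ∘ λ_Γ`. -/
def proj {d : ℕ} (Γ : ℝ → E d) (ℓ : ℝ) (x : E d) : E d :=
  Γ (projIndex Γ ℓ x)

/-! ### Conditional expectation and self-consistency -/

/-- `φ` is a version of `y ↦ 𝔼[X | Y = y]`: it is measurable, and `𝔼[X | σ(Y)] = φ ∘ Y`
almost surely. -/
def IsCondExpGiven {Ω : Type*} [MeasurableSpace Ω] (P : Measure Ω) {d : ℕ}
    (X : Ω → E d) (Y : Ω → ℝ) (φ : ℝ → E d) : Prop :=
  Measurable φ ∧ P[X | MeasurableSpace.comap Y inferInstance] =ᵐ[P] φ ∘ Y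

/-- `Γ` is self-consistent for `X`: `𝔼[X | λ_Γ(X) = s] = Γ s` for almost every `s` with respect
to the distribution of `λ_Γ(X)`. -/
def IsSelfConsistent {Ω : Type*} [MeasurableSpace Ω] (P : Measure Ω) {d : ℕ}
    (X : Ω → E d) (Γ : ℝ → E d) (ℓ : ℝ) : Prop :=
  ∃ φ : ℝ → E d, IsCondExpGiven P X (fun w => projIndex Γ ℓ (X w)) φ ∧
    ∀ᵐ s ∂(P.map fun w => projIndex Γ ℓ (X w)), φ s = Γ s

/-! ### Moving frames and normal coordinates -/

/-- `N₁, …, N_{d-1}` complete the tangent `T` of `Γ` to a smooth moving orthonormal frame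
`T, N₁, …, N_{d-1}` along `[0, ℓ]`. -/
structure IsNormalFrame {d : ℕ} (Γ : ℝ → E d) (ℓ : ℝ) (N : Fin (d - 1) → ℝ → E d) : Prop where
  smooth : ∀ i, ContDiffOn ℝ ∞ (N i) (Icc 0 ℓ)
  orthonormal : ∀ s ∈ Icc 0 ℓ, Orthonormal ℝ fun i => N i s
  normal : ∀ s ∈ Icc 0 ℓ, ∀ i, inner ℝ (tangent Γ ℓ s) (N i s) = 0

/-- The principal curvatures `κ_i = ⟨T', N_i⟩` with respect to the frame. -/
def principalCurvature {d : ℕ} (Γ : ℝ → E d) (ℓ : ℝ) (N : Fin (d - 1) → ℝ → E d)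
    (s : ℝ) : Fin (d - 1) → ℝ :=
  fun i => inner ℝ (derivWithin (tangent Γ ℓ) (Icc 0 ℓ) s) (N i s)

/-- The normal coordinate map `ν_Γ(s, u) = Γ(s) + ∑ u_i N_i(s)`. -/
def normalMap {d : ℕ} (Γ : ℝ → E d) (N : Fin (d - 1) → ℝ → E d)
    (q : ℝ × (Fin (d - 1) → ℝ)) : E d :=
  Γ q.1 + ∑ i, q.2 i • N i q.1

/-- The normal coordinate transformation
`μ_Γ(x) = (λ_Γ(x), ⟨x - π_Γ(x), N_i(λ_Γ(x))⟩_i)`. -/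
def normalTransform {d : ℕ} (Γ : ℝ → E d) (ℓ : ℝ) (N : Fin (d - 1) → ℝ → E d)
    (x : E d) : ℝ × (Fin (d - 1) → ℝ) :=
  (projIndex Γ ℓ x, fun i => inner ℝ (x - proj Γ ℓ x) (N i (projIndex Γ ℓ x)))

/-- The points `(λ_Γ⁻¹([0, ℓ]) ∩ 𝕏) ∖ 𝒜_Γ`. -/
def unambiguousPart {d : ℕ} (Γ : ℝ → E d) (ℓ : ℝ) (𝕏 : Set (E d)) : Set (E d) :=
  (projIndex Γ ℓ ⁻¹' Icc 0 ℓ ∩ 𝕏) \ ambiguitySet Γ ℓ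

/-- The normal coordinate map is a diffeomorphism on `(λ_Γ⁻¹([0, ℓ]) ∩ 𝕏) ∖ 𝒜_Γ`, meaning that
there `ν_Γ ∘ μ_Γ = id`, and that `μ_Γ` and `ν_Γ` are differentiable on the related domains. -/
structure IsNormalDiffeo {d : ℕ} (Γ : ℝ → E d) (ℓ : ℝ) (N : Fin (d - 1) → ℝ → E d)
    (𝕏 : Set (E d)) : Prop where
  leftInv : ∀ x ∈ unambiguousPart Γ ℓ 𝕏, normalMap Γ N (normalTransform Γ ℓ N x) = x
  differentiableOn_transform :
    DifferentiableOn ℝ (normalTransform Γ ℓ N) (unambiguousPart Γ ℓ 𝕏)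
  differentiableOn_map :
    DifferentiableOn ℝ (normalMap Γ N) (normalTransform Γ ℓ N '' unambiguousPart Γ ℓ 𝕏)

/-! ### Transverse moments -/

/-- The set `ℛ(s)` of normal coordinates `u` such that `Γ(s) + ∑ u_i N_i(s)` is not an ambiguity
point and projects to the parameter `s`. -/
def normalRegion {d : ℕ} (Γ : ℝ → E d) (ℓ : ℝ) (N : Fin (d - 1) → ℝ → E d) (s : ℝ) :
    Set (Fin (d - 1) → ℝ) :=
  {u | projIndex Γ ℓ (normalMap Γ N (s, u)) = s ∧ normalMap Γ N (s, u) ∉ ambiguitySet Γ ℓ}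

/-- The transverse moment `μ_j(s) = ∫_{ℛ(s)} u^j p(Γ(s) + ∑ u_i N_i(s)) du` of the
multi-index `j`. -/
def transverseMoment {d : ℕ} (p : E d → ℝ) (Γ : ℝ → E d) (ℓ : ℝ) (N : Fin (d - 1) → ℝ → E d)
    (j : Fin (d - 1) → ℕ) (s : ℝ) : ℝ :=
  ∫ u in normalRegion Γ ℓ N s, (∏ i, u i ^ j i) * p (normalMap Γ N (s, u))

/-- The vector `(μ_{e_i}(s))_i` of first transverse moments. -/
def momentVector {d : ℕ} (p : E d → ℝ) (Γ : ℝ → E d) (ℓ : ℝ) (N : Fin (d - 1) → ℝ → E d)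
    (s : ℝ) : Fin (d - 1) → ℝ :=
  fun i => transverseMoment p Γ ℓ N (Pi.single i 1) s

/-- The Gram matrix `(μ_{e_i + e_k}(s))_{i,k}` of second transverse moments. -/
def gramMatrix {d : ℕ} (p : E d → ℝ) (Γ : ℝ → E d) (ℓ : ℝ) (N : Fin (d - 1) → ℝ → E d)
    (s : ℝ) : Matrix (Fin (d - 1)) (Fin (d - 1)) ℝ :=
  Matrix.of fun i k => transverseMoment p Γ ℓ N (Pi.single i 1 + Pi.single k 1) s

end

end PrincipalCurve

/-! Self-consistency says that the bias X - π(X) has conditional mean zero given λ(X), i.e. that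
p(x)(x - π(x)) integrates to zero over λ⁻¹(B) for every Borel set B
(`isSelfConsistent_iff_forall_setIntegral`). In normal coordinates x = ν(s,u) the bias is ∑ uᵢNᵢ(s)
and the volume element is |1 - κ(s)·u| ds du. The second-order condition at a nearest point gives
κ·u ≤ 1, so the absolute value drops, and Fubini turns the integral into that of ∑ (μ - Gκ)ᵢNᵢ over
B ∩ [0,ℓ] (`IsBoundedAlong.setIntegral_preimage_projIndex`). It vanishes for all B iff μ = Gκ almost
everywhere.

The change of variables misses only ambiguity points. They form a null set: the distance to the
curve is Lipschitz, hence differentiable almost everywhere by Rademacher, and differentiability at a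
point forces a unique nearest point (`nearest_unique_of_differentiableAt`).

If p is continuous, μ and Gκ are continuous on [0,ℓ], so almost everywhere becomes everywhere. The
difficulty is that the domain ℛ(s) moves. By
`IsSmoothJordanCurve.ae_eventually_mem_normalRegion_iff`, at each s₀ and for almost every u,
membership in ℛ(s) does not change for s near s₀: the closed version of ℛ(s₀) is convex, so its
frontier is null; its interior points satisfy the defining inequalities strictly, which survives
perturbation by uniform Taylor estimates; at exterior points some inequality fails strictly.

The matrix G has the quadratic form v·Gv = ∫ (v·u)² p. If this vanishes for some v ≠ 0, then p = 0
almost everywhere on the slice, because a hyperplane is null. That is impossible if the slice has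
mass, or if Γ(s) is interior to 𝕏, as ℛ(s) is a neighbourhood of 0. If μ₀(s) = 0, all moments
involved vanish and the equation at s is void. -/

namespace PrincipalCurve

/-! ### Nearest points -/

/-- The derivative of the distance to a set in the direction of a nearest point. -/
theorem fderiv_infDist_of_nearest {F : Type*} [NormedAddCommGroup F] [NormedSpace ℝ F]
    {S : Set F} {x y : F} (hy : y ∈ S) (hxy : ‖x - y‖ = Metric.infDist x S)
    (hd : DifferentiableAt ℝ (fun z => Metric.infDist z S) x) :
    fderiv ℝ (fun z => Metric.infDist z S) x (y - x) = -‖x - y‖ := by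
  have h1 : HasDerivAt (fun t : ℝ => Metric.infDist (x + t • (y - x)) S)
      (fderiv ℝ (fun z => Metric.infDist z S) x (y - x)) 0 := by
    have hl : HasDerivAt (fun t : ℝ => x + t • (y - x)) (y - x) 0 := by
      simpa using ((hasDerivAt_id (0 : ℝ)).smul_const (y - x)).const_add x
    have := HasFDerivAt.comp_hasDerivAt (x := (0 : ℝ)) (f := fun t : ℝ => x + t • (y - x))
      (l := fun z => Metric.infDist z S) (by simpa using hd.hasFDerivAt) hl
    exact this
  have h2 : HasDerivWithinAt (fun t : ℝ => Metric.infDist (x + t • (y - x)) S)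
      (-‖x - y‖) (Icc 0 1) 0 := by
    have h3 : HasDerivWithinAt (fun t : ℝ => ‖x - y‖ - t * ‖x - y‖) (-‖x - y‖) (Icc 0 1) 0 := by
      simpa using (((hasDerivAt_id (0 : ℝ)).mul_const ‖x - y‖).const_sub ‖x - y‖).hasDerivWithinAt
    -- On the segment from x to y the distance is affine: y bounds it above, the Lipschitz property
    -- below.
    have key : ∀ t ∈ Icc (0 : ℝ) 1,
        Metric.infDist (x + t • (y - x)) S = ‖x - y‖ - t * ‖x - y‖ := by
      intro t ht
      apply le_antisymm
      · refine (Metric.infDist_le_dist_of_mem hy).trans (le_of_eq ?_)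
        rw [dist_eq_norm, show x + t • (y - x) - y = (1 - t) • (x - y) by module, norm_smul,
          Real.norm_of_nonneg (by linarith [ht.2])]
        ring
      · have := Metric.infDist_le_infDist_add_dist (s := S) (x := x) (y := x + t • (y - x))
        rw [dist_eq_norm, show x - (x + t • (y - x)) = t • (x - y) by module, norm_smul,
          Real.norm_of_nonneg ht.1, ← hxy] at this
        linarith
    exact h3.congr key (by simpa using key 0 (by simp))
  exact (uniqueDiffOn_Icc zero_lt_one 0 (by simp)).eq_deriv _ h1.hasDerivWithinAt h2

/-- At a point of differentiability of the distance to `S`, the nearest point is unique. -/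
theorem nearest_unique_of_differentiableAt {F : Type*} [NormedAddCommGroup F]
    [InnerProductSpace ℝ F] {S : Set F} {x y z : F} (hy : y ∈ S) (hz : z ∈ S)
    (hxy : ‖x - y‖ = Metric.infDist x S) (hxz : ‖x - z‖ = Metric.infDist x S)
    (hd : DifferentiableAt ℝ (fun z => Metric.infDist z S) x) : y = z := by
  have h1 := fderiv_infDist_of_nearest hy hxy hd
  have h2 := fderiv_infDist_of_nearest hz hxz hd
  have h3 : ‖fderiv ℝ (fun z => Metric.infDist z S) x‖ ≤ 1 := by
    simpa using norm_fderiv_le_of_lipschitz ℝ (x₀ := x) (Metric.lipschitz_infDist_pt S)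
  have h4 := (fderiv ℝ (fun z => Metric.infDist z S) x).le_of_opNorm_le h3 ((y - x) + (z - x))
  rw [map_add, h1, h2, hxz, ← hxy, Real.norm_eq_abs] at h4
  have h5 := neg_le_abs (-‖x - y‖ + -‖x - y‖)
  have h6 := parallelogram_law_with_norm ℝ (y - x) (z - x)
  have h7 : ‖y - x‖ = ‖x - y‖ := norm_sub_rev _ _
  have h8 : ‖z - x‖ = ‖x - y‖ := by rw [norm_sub_rev, hxz, hxy]
  rw [h7, h8] at h6
  -- The derivative has norm at most 1, so ‖(y - x) + (z - x)‖ ≥ 2‖x - y‖; the parallelogram law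
  -- then leaves nothing for the difference.
  have h9 : ‖y - x - (z - x)‖ = 0 := by
    have := norm_nonneg (x - y)
    have : (2 * ‖x - y‖) * (2 * ‖x - y‖) ≤ ‖y - x + (z - x)‖ * ‖y - x + (z - x)‖ :=
      mul_self_le_mul_self (by positivity) (by linarith)
    exact mul_self_eq_zero.1 (le_antisymm (by linarith) (mul_self_nonneg _))
  rw [norm_eq_zero] at h9
  have := sub_eq_zero.1 h9
  simpa using this

section NearestPoints

variable {d : ℕ} {Γ : ℝ → E d} {ℓ : ℝ} {N : Fin (d - 1) → ℝ → E d}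

theorem IsSmoothJordanCurve.continuousOn (hΓ : IsSmoothJordanCurve Γ ℓ) :
    ContinuousOn Γ (Icc 0 ℓ) := hΓ.smooth.continuousOn

theorem IsSmoothJordanCurve.zero_mem (hΓ : IsSmoothJordanCurve Γ ℓ) : (0 : ℝ) ∈ Icc 0 ℓ :=
  ⟨le_rfl, hΓ.length_pos.le⟩

theorem IsSmoothJordanCurve.isCompact_image (hΓ : IsSmoothJordanCurve Γ ℓ) {a b : ℝ}
    (h : Icc a b ⊆ Icc 0 ℓ) : IsCompact (Γ '' Icc a b) :=
  isCompact_Icc.image_of_continuousOn (hΓ.continuousOn.mono h)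

/-- Rademacher's theorem for the distance to the curve: an ambiguity point cannot be a point of
differentiability. -/
theorem IsSmoothJordanCurve.volume_ambiguitySet :
    volume (ambiguitySet Γ ℓ) = 0 := by
  have h := (Metric.lipschitz_infDist_pt (Γ '' Icc 0 ℓ)).ae_differentiableAt
    (μ := (volume : Measure (E d)))
  refine measure_mono_null ?_ h
  rintro x ⟨s, hs, t, ht, hst⟩ hx
  exact hst (nearest_unique_of_differentiableAt (mem_image_of_mem _ hs.1)
    (mem_image_of_mem _ ht.1) hs.2 ht.2 hx)

theorem mem_closestParams_iff {x : E d} {s : ℝ} :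
    s ∈ closestParams Γ ℓ x ↔ s ∈ Icc 0 ℓ ∧ ∀ t ∈ Icc 0 ℓ, ‖x - Γ s‖ ≤ ‖x - Γ t‖ := by
  refine and_congr_right fun hs => ⟨fun h t ht => ?_, fun h => ?_⟩
  · rw [h, ← dist_eq_norm]
    exact Metric.infDist_le_dist_of_mem (mem_image_of_mem _ ht)
  · refine le_antisymm ?_ ?_
    · refine (Metric.le_infDist ⟨_, mem_image_of_mem _ hs⟩).2 ?_
      rintro _ ⟨t, ht, rfl⟩
      rw [dist_eq_norm]
      exact h t ht
    · rw [← dist_eq_norm]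
      exact Metric.infDist_le_dist_of_mem (mem_image_of_mem _ hs)

/-- Replaces an existential over parameters by an inequality between two continuous functions of x;
the measurability proofs rest on this. -/
theorem IsSmoothJordanCurve.exists_mem_closestParams_iff (hΓ : IsSmoothJordanCurve Γ ℓ)
    {a b : ℝ} (hab : a ≤ b) (h : Icc a b ⊆ Icc 0 ℓ) (x : E d) :
    (∃ s ∈ Icc a b, s ∈ closestParams Γ ℓ x) ↔
      Metric.infDist x (Γ '' Icc a b) ≤ Metric.infDist x (Γ '' Icc 0 ℓ) := by
  constructor
  · rintro ⟨s, hs, hs'⟩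
    rw [← hs'.2, ← dist_eq_norm]
    exact Metric.infDist_le_dist_of_mem (mem_image_of_mem _ hs)
  · intro hle
    obtain ⟨_, ⟨s, hs, rfl⟩, hy⟩ := (hΓ.isCompact_image h).exists_infDist_eq_dist
      ((nonempty_Icc.2 hab).image Γ) x
    refine ⟨s, hs, h hs, ?_⟩
    rw [← dist_eq_norm, ← hy]
    exact le_antisymm hle (Metric.infDist_le_infDist_of_subset (image_mono h) ((nonempty_Icc.2 hab).image Γ))

theorem IsSmoothJordanCurve.projIndex_mem_closestParams (hΓ : IsSmoothJordanCurve Γ ℓ) (x : E d) :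
    projIndex Γ ℓ x ∈ closestParams Γ ℓ x := by
  have hne : (closestParams Γ ℓ x).Nonempty := by
    obtain ⟨s, -, hs⟩ := (hΓ.exists_mem_closestParams_iff hΓ.length_pos.le le_rfl x).2 le_rfl
    exact ⟨s, hs⟩
  have hc : IsClosed (closestParams Γ ℓ x) := by
    have : ContinuousOn (fun s => ‖x - Γ s‖) (Icc 0 ℓ) := by
      have := hΓ.continuousOn
      fun_prop
    exact this.preimage_isClosed_of_isClosed isClosed_Icc isClosed_singleton
  exact hc.csSup_mem hne ⟨ℓ, fun s hs => hs.1.2⟩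

theorem IsSmoothJordanCurve.projIndex_mem (hΓ : IsSmoothJordanCurve Γ ℓ) (x : E d) :
    projIndex Γ ℓ x ∈ Icc 0 ℓ := (hΓ.projIndex_mem_closestParams x).1

theorem le_projIndex {x : E d} {s : ℝ} (hs : s ∈ closestParams Γ ℓ x) : s ≤ projIndex Γ ℓ x :=
  le_csSup ⟨ℓ, fun _ hs => hs.1.2⟩ hs

/-- Since the largest closest parameter is selected, λ(x) ≥ c means that some closest parameter lies
in [c, ℓ], which is a closed condition on x. -/
theorem IsSmoothJordanCurve.measurable_projIndex (hΓ : IsSmoothJordanCurve Γ ℓ) :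
    Measurable (projIndex Γ ℓ) := by
  refine measurable_of_Ici fun c => ?_
  rcases le_or_gt c ℓ with hc | hc
  · have hsub : Icc (max 0 c) ℓ ⊆ Icc 0 ℓ := Icc_subset_Icc_left (le_max_left _ _)
    have : projIndex Γ ℓ ⁻¹' Ici c = {x | Metric.infDist x (Γ '' Icc (max 0 c) ℓ) ≤
        Metric.infDist x (Γ '' Icc 0 ℓ)} := by
      ext x
      rw [mem_ofPred_eq, ← hΓ.exists_mem_closestParams_iff (max_le hΓ.length_pos.le hc) hsub]
      constructor
      · intro h
        exact ⟨_, ⟨max_le (hΓ.projIndex_mem x).1 h, (hΓ.projIndex_mem x).2⟩,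
          hΓ.projIndex_mem_closestParams x⟩
      · rintro ⟨s, hs, hs'⟩
        exact ((le_max_right _ _).trans hs.1).trans (le_projIndex hs')
    rw [this]
    exact (isClosed_le (Metric.continuous_infDist_pt _) (Metric.continuous_infDist_pt _)).measurableSet
  · have : projIndex Γ ℓ ⁻¹' Ici c = ∅ := by
      ext x
      simpa using (hΓ.projIndex_mem x).2.trans_lt hc
    rw [this]
    exact .empty

theorem IsSmoothJordanCurve.mem_ambiguitySet_iff (hΓ : IsSmoothJordanCurve Γ ℓ) {x : E d} :
    x ∈ ambiguitySet Γ ℓ ↔ ∃ s ∈ closestParams Γ ℓ x, s < projIndex Γ ℓ x := by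
  constructor
  · rintro ⟨s, hs, t, ht, hst⟩
    by_contra! h
    have h1 : s = projIndex Γ ℓ x := le_antisymm (le_projIndex hs) (h s hs)
    have h2 : t = projIndex Γ ℓ x := le_antisymm (le_projIndex ht) (h t ht)
    exact hst (by rw [h1, h2])
  · rintro ⟨s, hs, hlt⟩
    exact ⟨s, hs, _, hΓ.projIndex_mem_closestParams x,
      fun h => hlt.ne (hΓ.injOn hs.1 (hΓ.projIndex_mem x) h)⟩

theorem IsSmoothJordanCurve.measurableSet_ambiguitySet (hΓ : IsSmoothJordanCurve Γ ℓ) :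
    MeasurableSet (ambiguitySet Γ ℓ) := by
  -- A rational q separates a smaller closest parameter from the largest one, so a countable union
  -- suffices.
  have : ambiguitySet Γ ℓ = ⋃ q : ℚ, ⋃ _ : (q : ℝ) ∈ Icc 0 ℓ,
      {x | Metric.infDist x (Γ '' Icc 0 (q : ℝ)) ≤ Metric.infDist x (Γ '' Icc 0 ℓ)} ∩
        projIndex Γ ℓ ⁻¹' Ioi (q : ℝ) := by
    ext x
    simp only [mem_iUnion, mem_inter_iff, mem_ofPred_eq, mem_preimage, mem_Ioi, exists_prop]
    rw [hΓ.mem_ambiguitySet_iff]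
    constructor
    · rintro ⟨s, hs, hlt⟩
      obtain ⟨q, hq1, hq2⟩ := exists_rat_btwn hlt
      have hq : (q : ℝ) ∈ Icc 0 ℓ := ⟨hs.1.1.trans hq1.le, hq2.le.trans (hΓ.projIndex_mem x).2⟩
      exact ⟨q, hq, (hΓ.exists_mem_closestParams_iff hq.1 (Icc_subset_Icc_right hq.2) x).1
        ⟨s, ⟨hs.1.1, hq1.le⟩, hs⟩, hq2⟩
    · rintro ⟨q, hq, h1, h2⟩
      obtain ⟨s, hs, hs'⟩ :=
        (hΓ.exists_mem_closestParams_iff hq.1 (Icc_subset_Icc_right hq.2) x).2 h1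
      exact ⟨s, hs', hs.2.trans_lt h2⟩
  rw [this]
  refine .iUnion fun q => .iUnion fun _ => .inter ?_ (hΓ.measurable_projIndex measurableSet_Ioi)
  exact (isClosed_le (Metric.continuous_infDist_pt _) (Metric.continuous_infDist_pt _)).measurableSet

/-- A point projects unambiguously to `s` iff `Γ s` is its strictly nearest point. -/
theorem IsSmoothJordanCurve.projIndex_eq_iff (hΓ : IsSmoothJordanCurve Γ ℓ) {x : E d} {s : ℝ}
    (hs : s ∈ Icc 0 ℓ) :
    (projIndex Γ ℓ x = s ∧ x ∉ ambiguitySet Γ ℓ) ↔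
      ∀ t ∈ Icc 0 ℓ, t ≠ s → ‖x - Γ s‖ < ‖x - Γ t‖ := by
  constructor
  · rintro ⟨rfl, hx⟩ t ht hts
    have h1 := hΓ.projIndex_mem_closestParams x
    have h2 := (mem_closestParams_iff.1 h1).2
    refine lt_of_le_of_ne (h2 t ht) fun heq => hx ?_
    refine ⟨_, h1, t, ⟨ht, heq.symm.trans h1.2⟩, fun h => hts (hΓ.injOn ht h1.1 h.symm)⟩
  · intro h
    have key : ∀ t ∈ closestParams Γ ℓ x, t = s := by
      intro t ht
      by_contra hts
      exact absurd ((mem_closestParams_iff.1 ht).2 s hs) (not_le.2 (h t ht.1 hts))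
    refine ⟨key _ (hΓ.projIndex_mem_closestParams x), ?_⟩
    rintro ⟨a, ha, b, hb, hab⟩
    exact hab (by rw [key a ha, key b hb])

end NearestPoints

/-! ### Taylor expansion of the curve and the normal regions -/

section Taylor

open Topology Filter

variable {d : ℕ} {Γ : ℝ → E d} {ℓ : ℝ} {N : Fin (d - 1) → ℝ → E d}

theorem IsSmoothJordanCurve.uniqueDiffOn (hΓ : IsSmoothJordanCurve Γ ℓ) :
    UniqueDiffOn ℝ (Icc 0 ℓ) := uniqueDiffOn_Icc hΓ.length_pos

theorem IsSmoothJordanCurve.contDiffOn_tangent (hΓ : IsSmoothJordanCurve Γ ℓ) :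
    ContDiffOn ℝ ∞ (tangent Γ ℓ) (Icc 0 ℓ) :=
  hΓ.smooth.derivWithin hΓ.uniqueDiffOn (by simp)

theorem IsSmoothJordanCurve.continuousOn_tangent (hΓ : IsSmoothJordanCurve Γ ℓ) :
    ContinuousOn (tangent Γ ℓ) (Icc 0 ℓ) := hΓ.contDiffOn_tangent.continuousOn

theorem IsSmoothJordanCurve.continuousOn_derivWithin_tangent (hΓ : IsSmoothJordanCurve Γ ℓ) :
    ContinuousOn (derivWithin (tangent Γ ℓ) (Icc 0 ℓ)) (Icc 0 ℓ) :=
  hΓ.contDiffOn_tangent.continuousOn_derivWithin hΓ.uniqueDiffOn (by simp)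

theorem IsSmoothJordanCurve.hasDerivWithinAt (hΓ : IsSmoothJordanCurve Γ ℓ) {s : ℝ}
    (hs : s ∈ Icc 0 ℓ) : HasDerivWithinAt Γ (tangent Γ ℓ s) (Icc 0 ℓ) s :=
  (hΓ.smooth.differentiableOn (by simp) s hs).hasDerivWithinAt

theorem IsSmoothJordanCurve.hasDerivWithinAt_tangent (hΓ : IsSmoothJordanCurve Γ ℓ) {s : ℝ}
    (hs : s ∈ Icc 0 ℓ) :
    HasDerivWithinAt (tangent Γ ℓ) (derivWithin (tangent Γ ℓ) (Icc 0 ℓ) s) (Icc 0 ℓ) s :=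
  (hΓ.contDiffOn_tangent.differentiableOn (by simp) s hs).hasDerivWithinAt

theorem IsSmoothJordanCurve.norm_sub_le (hΓ : IsSmoothJordanCurve Γ ℓ) {s t : ℝ}
    (hs : s ∈ Icc 0 ℓ) (ht : t ∈ Icc 0 ℓ) : ‖Γ t - Γ s‖ ≤ |t - s| := by
  simpa using (convex_Icc 0 ℓ).norm_image_sub_le_of_norm_hasDerivWithin_le
    (fun x hx => hΓ.hasDerivWithinAt hx) (fun x hx => (hΓ.arcLength x hx).le) hs ht

/-- First order Taylor expansion, uniform in both parameters. -/
theorem IsSmoothJordanCurve.taylor_one (hΓ : IsSmoothJordanCurve Γ ℓ) {s₀ : ℝ}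
    (hs₀ : s₀ ∈ Icc 0 ℓ) {ε : ℝ} (hε : 0 < ε) :
    ∃ δ > 0, ∀ s ∈ Icc 0 ℓ, ∀ t ∈ Icc 0 ℓ, |s - s₀| < δ → |t - s₀| < δ →
      ‖Γ t - Γ s - (t - s) • tangent Γ ℓ s₀‖ ≤ ε * |t - s| := by
  obtain ⟨δ, hδ, h⟩ := Metric.continuousOn_iff.1 hΓ.continuousOn_tangent s₀ hs₀ ε hε
  refine ⟨δ, hδ, fun s hs t ht hss hts => ?_⟩
  have hconv : Convex ℝ (Icc 0 ℓ ∩ Metric.ball s₀ δ) :=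
    (convex_Icc 0 ℓ).inter (convex_ball s₀ δ)
  have := hconv.norm_image_sub_le_of_norm_hasDerivWithin_le
    (f := fun t => Γ t - t • tangent Γ ℓ s₀) (f' := fun t => tangent Γ ℓ t - tangent Γ ℓ s₀)
    (C := ε) (x := s) (y := t) ?_ ?_ ⟨hs, by simpa [Real.dist_eq] using hss⟩
      ⟨ht, by simpa [Real.dist_eq] using hts⟩
  · rw [Real.norm_eq_abs] at this
    refine le_of_eq_of_le (congrArg norm ?_) this
    module
  · intro x hx
    have := ((hasDerivAt_id x).smul_const (tangent Γ ℓ s₀)).hasDerivWithinAt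
      (s := Icc 0 ℓ ∩ Metric.ball s₀ δ)
    simpa using ((hΓ.hasDerivWithinAt hx.1).mono inter_subset_left).fun_sub this
  · intro x hx
    rw [← dist_eq_norm]
    exact (h x hx.1 hx.2).le

/-- Second order Taylor expansion, uniform in both parameters. -/
theorem IsSmoothJordanCurve.taylor_two (hΓ : IsSmoothJordanCurve Γ ℓ) {s₀ : ℝ}
    (hs₀ : s₀ ∈ Icc 0 ℓ) {ε : ℝ} (hε : 0 < ε) :
    ∃ δ > 0, ∀ s ∈ Icc 0 ℓ, ∀ t ∈ Icc 0 ℓ, |s - s₀| < δ → |t - s₀| < δ →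
      ‖Γ t - Γ s - (t - s) • tangent Γ ℓ s -
        ((t - s) ^ 2 / 2) • derivWithin (tangent Γ ℓ) (Icc 0 ℓ) s₀‖ ≤ ε * (t - s) ^ 2 := by
  set C := derivWithin (tangent Γ ℓ) (Icc 0 ℓ) with hC
  obtain ⟨δ, hδ, h⟩ := Metric.continuousOn_iff.1 hΓ.continuousOn_derivWithin_tangent s₀ hs₀ ε hε
  refine ⟨δ, hδ, fun s hs t ht hss hts => ?_⟩
  have hconv : Convex ℝ (Icc 0 ℓ ∩ Metric.ball s₀ δ) :=
    (convex_Icc 0 ℓ).inter (convex_ball s₀ δ)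
  have hsm : s ∈ Icc 0 ℓ ∩ Metric.ball s₀ δ := ⟨hs, by simpa [Real.dist_eq] using hss⟩
  have htm : t ∈ Icc 0 ℓ ∩ Metric.ball s₀ δ := ⟨ht, by simpa [Real.dist_eq] using hts⟩
  have h1 : ∀ x ∈ Icc 0 ℓ ∩ Metric.ball s₀ δ,
      ‖tangent Γ ℓ x - tangent Γ ℓ s - (x - s) • C s₀‖ ≤ ε * |x - s| := by
    intro x hx
    have := hconv.norm_image_sub_le_of_norm_hasDerivWithin_le
      (f := fun t => tangent Γ ℓ t - t • C s₀) (f' := fun t => C t - C s₀)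
      (C := ε) (x := s) (y := x) ?_ ?_ hsm hx
    · rw [Real.norm_eq_abs] at this
      refine le_of_eq_of_le (congrArg norm ?_) this
      module
    · intro x hx
      have := ((hasDerivAt_id x).smul_const (C s₀)).hasDerivWithinAt
        (s := Icc 0 ℓ ∩ Metric.ball s₀ δ)
      simpa using ((hΓ.hasDerivWithinAt_tangent hx.1).mono inter_subset_left).fun_sub this
    · intro x hx
      rw [← dist_eq_norm]
      exact (h x hx.1 hx.2).le
  have hsub : uIcc s t ⊆ Icc 0 ℓ ∩ Metric.ball s₀ δ := hconv.ordConnected.uIcc_subset hsm htm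
  have h2 := (convex_uIcc s t).norm_image_sub_le_of_norm_hasDerivWithin_le
    (f := fun x => Γ x - (x - s) • tangent Γ ℓ s - ((x - s) ^ 2 / 2) • C s₀)
    (f' := fun x => tangent Γ ℓ x - tangent Γ ℓ s - (x - s) • C s₀)
    (C := ε * |t - s|) (x := s) (y := t) ?_ ?_ left_mem_uIcc right_mem_uIcc
  · rw [Real.norm_eq_abs, mul_assoc, abs_mul_abs_self, ← sq] at h2
    refine le_of_eq_of_le (congrArg norm ?_) h2
    simp only [sub_self, ne_eq, OfNat.ofNat_ne_zero, not_false_eq_true, zero_pow, zero_div,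
      zero_smul, sub_zero]
    abel
  · intro x hx
    have e1 : HasDerivWithinAt (fun x : ℝ => (x - s) • tangent Γ ℓ s) ((1 : ℝ) • tangent Γ ℓ s)
        (uIcc s t) x :=
      (((hasDerivAt_id x).sub_const s).smul_const _).hasDerivWithinAt
    have e2 : HasDerivWithinAt (fun x : ℝ => ((x - s) ^ 2 / 2) • C s₀) ((x - s) • C s₀)
        (uIcc s t) x := by
      have := ((((hasDerivAt_id' x).sub_const s).pow 2).div_const 2).smul_const (C s₀)
      refine HasDerivAt.hasDerivWithinAt ?_
      have h3 : ((2 : ℕ) : ℝ) * (x - s) ^ (2 - 1) * 1 / 2 = x - s := by norm_num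
      rw [h3] at this
      exact this
    rw [one_smul] at e1
    exact (((hΓ.hasDerivWithinAt (hsub hx).1).mono fun y hy => (hsub hy).1).fun_sub e1).fun_sub e2
  · intro x hx
    refine (h1 x (hsub hx)).trans ?_
    exact mul_le_mul_of_nonneg_left (abs_sub_left_of_mem_uIcc hx) hε.le

end Taylor

/-! ### Normal regions as solution sets of inequalities in the normal coordinates -/

section Region

open Topology Filter

variable {d : ℕ} {Γ : ℝ → E d} {ℓ : ℝ} {N : Fin (d - 1) → ℝ → E d}

/-- The normal vector `∑ u_i N_i(s)` with normal coordinates `u`. -/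
noncomputable def normalVec (N : Fin (d - 1) → ℝ → E d) (s : ℝ) (u : Fin (d - 1) → ℝ) : E d :=
  ∑ i, u i • N i s

theorem normalMap_eq (s : ℝ) (u : Fin (d - 1) → ℝ) :
    normalMap Γ N (s, u) = Γ s + normalVec N s u := rfl

theorem normalVec_smul (s c : ℝ) (u : Fin (d - 1) → ℝ) :
    normalVec N s (c • u) = c • normalVec N s u := by
  simp [normalVec, Finset.smul_sum, smul_smul]

theorem normalVec_add (s : ℝ) (u v : Fin (d - 1) → ℝ) :
    normalVec N s (u + v) = normalVec N s u + normalVec N s v := by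
  simp [normalVec, Finset.sum_add_distrib, add_smul]

theorem continuous_normalVec (s : ℝ) : Continuous (normalVec N s) := by
  unfold normalVec
  fun_prop

theorem IsNormalFrame.continuousOn (hN : IsNormalFrame Γ ℓ N) (i : Fin (d - 1)) :
    ContinuousOn (N i) (Icc 0 ℓ) := (hN.smooth i).continuousOn

theorem IsNormalFrame.continuousOn_normalVec (hN : IsNormalFrame Γ ℓ N) :
    ContinuousOn (fun q : ℝ × (Fin (d - 1) → ℝ) => normalVec N q.1 q.2) (Icc 0 ℓ ×ˢ univ) := by
  unfold normalVec
  refine continuousOn_finsetSum _ fun i _ => ?_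
  have h1 : Continuous fun q : ℝ × (Fin (d - 1) → ℝ) => q.2 i := by fun_prop
  refine h1.continuousOn.smul ?_
  exact (hN.continuousOn i).comp continuousOn_fst fun q hq => hq.1

theorem IsNormalFrame.inner_tangent_normalVec (hN : IsNormalFrame Γ ℓ N) {s : ℝ}
    (hs : s ∈ Icc 0 ℓ) (u : Fin (d - 1) → ℝ) : inner ℝ (tangent Γ ℓ s) (normalVec N s u) = 0 := by
  simp [normalVec, inner_sum, inner_smul_right, hN.normal s hs]

theorem IsNormalFrame.inner_normalVec_right (hN : IsNormalFrame Γ ℓ N) {s : ℝ}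
    (hs : s ∈ Icc 0 ℓ) (u : Fin (d - 1) → ℝ) (i : Fin (d - 1)) :
    inner ℝ (normalVec N s u) (N i s) = u i := by
  simpa [normalVec] using (hN.orthonormal s hs).inner_left_fintype u i

theorem IsNormalFrame.norm_normalVec_sq (hN : IsNormalFrame Γ ℓ N) {s : ℝ}
    (hs : s ∈ Icc 0 ℓ) (u : Fin (d - 1) → ℝ) : ‖normalVec N s u‖ ^ 2 = ∑ i, u i ^ 2 := by
  rw [← real_inner_self_eq_norm_sq]
  nth_rw 2 [normalVec]
  simp [inner_sum, inner_smul_right, hN.inner_normalVec_right hs, sq]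

theorem inner_derivWithin_tangent_normalVec (s : ℝ) (u : Fin (d - 1) → ℝ) :
    inner ℝ (derivWithin (tangent Γ ℓ) (Icc 0 ℓ) s) (normalVec N s u) =
      principalCurvature Γ ℓ N s ⬝ᵥ u := by
  simp [normalVec, inner_sum, inner_smul_right, principalCurvature, dotProduct, mul_comm]

/-- The excess `‖ν(s,u) - Γ(t)‖² - ‖ν(s,u) - Γ(s)‖²`. -/
noncomputable def gap (Γ : ℝ → E d) (N : Fin (d - 1) → ℝ → E d) (s : ℝ) (u : Fin (d - 1) → ℝ)
    (t : ℝ) : ℝ :=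
  ‖Γ t - Γ s‖ ^ 2 - 2 * inner ℝ (Γ t - Γ s) (normalVec N s u)

theorem gap_eq (s : ℝ) (u : Fin (d - 1) → ℝ) (t : ℝ) :
    gap Γ N s u t = ‖normalMap Γ N (s, u) - Γ t‖ ^ 2 - ‖normalMap Γ N (s, u) - Γ s‖ ^ 2 := by
  have h1 : normalMap Γ N (s, u) - Γ t = normalVec N s u - (Γ t - Γ s) := by
    rw [normalMap_eq]; abel
  have h2 : normalMap Γ N (s, u) - Γ s = normalVec N s u := by
    rw [normalMap_eq]; abel
  rw [h1, h2, norm_sub_sq_real, gap, real_inner_comm]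
  ring

theorem IsSmoothJordanCurve.mem_normalRegion_iff (hΓ : IsSmoothJordanCurve Γ ℓ) {s : ℝ}
    (hs : s ∈ Icc 0 ℓ) {u : Fin (d - 1) → ℝ} :
    u ∈ normalRegion Γ ℓ N s ↔ ∀ t ∈ Icc 0 ℓ, t ≠ s → 0 < gap Γ N s u t := by
  refine (hΓ.projIndex_eq_iff hs).trans ?_
  refine forall₃_congr fun t _ _ => ?_
  rw [gap_eq, sub_pos, sq_lt_sq₀ (norm_nonneg _) (norm_nonneg _)]

/-- The closed convex set of normal coordinates `u` such that `Γ(s)` is a nearest point of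
`ν(s,u)`. -/
def closedNormalRegion (Γ : ℝ → E d) (ℓ : ℝ) (N : Fin (d - 1) → ℝ → E d) (s : ℝ) :
    Set (Fin (d - 1) → ℝ) :=
  {u | ∀ t ∈ Icc 0 ℓ, 0 ≤ gap Γ N s u t}

theorem gap_self (s : ℝ) (u : Fin (d - 1) → ℝ) : gap Γ N s u s = 0 := by simp [gap]

theorem IsSmoothJordanCurve.normalRegion_subset (hΓ : IsSmoothJordanCurve Γ ℓ) {s : ℝ}
    (hs : s ∈ Icc 0 ℓ) : normalRegion Γ ℓ N s ⊆ closedNormalRegion Γ ℓ N s := by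
  intro u hu t ht
  rcases eq_or_ne t s with rfl | hts
  · rw [gap_self]
  · exact ((hΓ.mem_normalRegion_iff hs).1 hu t ht hts).le

/-- For fixed s and t the excess is affine in u, so the set is an intersection of half-spaces (or
trivial conditions). -/
theorem convex_closedNormalRegion (s : ℝ) : Convex ℝ (closedNormalRegion Γ ℓ N s) := by
  intro u hu v hv a b ha hb hab t ht
  have h1 := mul_nonneg ha (hu t ht)
  have h2 := mul_nonneg hb (hv t ht)
  simp only [gap, normalVec_add, normalVec_smul, inner_add_right, inner_smul_right] at *
  have : a = 1 - b := by linarith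
  subst this
  linarith

/-- Second-order condition at a minimum: as t → s, the excess is (1 - κ·u)(t - s)² up to o((t -
s)²), and it is nonnegative. This fixes the sign of the Jacobian. -/
theorem IsSmoothJordanCurve.dotProduct_le_one (hΓ : IsSmoothJordanCurve Γ ℓ)
    (hN : IsNormalFrame Γ ℓ N) {s : ℝ} (hs : s ∈ Icc 0 ℓ) {u : Fin (d - 1) → ℝ}
    (hu : u ∈ closedNormalRegion Γ ℓ N s) : principalCurvature Γ ℓ N s ⬝ᵥ u ≤ 1 := by
  refine le_of_forall_pos_le_add fun ε hε => ?_
  set n := normalVec N s u with hn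
  have hpos : 0 < 2 * (‖n‖ + 1) := by positivity
  obtain ⟨δ, hδ, h⟩ := hΓ.taylor_two hs (div_pos hε hpos)
  -- One nearby parameter is enough; at s = ℓ it has to be taken to the left.
  obtain ⟨t, ht, hts, htδ⟩ : ∃ t ∈ Icc 0 ℓ, t ≠ s ∧ |t - s| < δ := by
    have hℓ := hΓ.length_pos
    rcases lt_or_ge s ℓ with hsl | hsl
    · refine ⟨s + min (ℓ - s) (δ / 2), ⟨?_, ?_⟩, ?_, ?_⟩
      · have := lt_min (sub_pos.2 hsl) (half_pos hδ)
        linarith [hs.1]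
      · linarith [min_le_left (ℓ - s) (δ / 2)]
      · have := lt_min (sub_pos.2 hsl) (half_pos hδ)
        linarith
      · have := lt_min (sub_pos.2 hsl) (half_pos hδ)
        rw [add_sub_cancel_left, abs_of_pos this]
        linarith [min_le_right (ℓ - s) (δ / 2)]
    · have h0 : s = ℓ := le_antisymm hs.2 hsl
      subst h0
      have := lt_min hℓ (half_pos hδ)
      refine ⟨s - min s (δ / 2), ⟨?_, ?_⟩, ?_, ?_⟩
      · linarith [min_le_left s (δ / 2)]
      · linarith
      · linarith
      · rw [sub_sub_cancel_left, abs_neg, abs_of_pos this]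
        linarith [min_le_right s (δ / 2)]
  have h1 := h s hs t ht (by simpa using hδ) htδ
  have h2 := hu t ht
  have h3 := hΓ.norm_sub_le hs ht
  have h4 : ‖Γ t - Γ s‖ ^ 2 ≤ (t - s) ^ 2 := by
    rw [← sq_abs (t - s)]
    gcongr
  have h5 := (abs_le.1 (abs_real_inner_le_norm (Γ t - Γ s - (t - s) • tangent Γ ℓ s -
        ((t - s) ^ 2 / 2) • derivWithin (tangent Γ ℓ) (Icc 0 ℓ) s) n)).1
  rw [inner_sub_left, inner_sub_left, inner_smul_left, inner_smul_left,
    hN.inner_tangent_normalVec hs, inner_derivWithin_tangent_normalVec] at h5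
  have h6 := mul_le_mul_of_nonneg_right h1 (norm_nonneg n)
  have h7 : 0 < (t - s) ^ 2 := by
    have := sub_ne_zero.2 hts
    positivity
  have h8 : ε / (2 * (‖n‖ + 1)) * (t - s) ^ 2 * ‖n‖ ≤ (t - s) ^ 2 * (ε / 2) := by
    have : ε / (2 * (‖n‖ + 1)) * ‖n‖ ≤ ε / 2 := by
      rw [div_mul_eq_mul_div, div_le_div_iff₀ hpos two_pos]
      nlinarith [norm_nonneg n]
    nlinarith
  simp only [gap, ← hn] at h2
  simp only [conj_trivial] at h5
  have h9 : (t - s) ^ 2 * (principalCurvature Γ ℓ N s ⬝ᵥ u) ≤ (t - s) ^ 2 * (1 + ε) := by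
    linarith
  exact le_of_mul_le_mul_left h9 h7

end Region

/-! ### Stability of the normal regions under change of the parameter -/

section Openness

open Topology Filter

variable {d : ℕ} {Γ : ℝ → E d} {ℓ : ℝ} {N : Fin (d - 1) → ℝ → E d}

theorem IsSmoothJordanCurve.continuousOn_gap (hΓ : IsSmoothJordanCurve Γ ℓ)
    (hN : IsNormalFrame Γ ℓ N) :
    ContinuousOn (fun z : (ℝ × (Fin (d - 1) → ℝ)) × ℝ => gap Γ N z.1.1 z.1.2 z.2)
      ((Icc 0 ℓ ×ˢ univ) ×ˢ Icc 0 ℓ) := by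
  have h1 : ContinuousOn (fun z : (ℝ × (Fin (d - 1) → ℝ)) × ℝ => Γ z.2 - Γ z.1.1)
      ((Icc 0 ℓ ×ˢ univ) ×ˢ Icc 0 ℓ) :=
    (hΓ.continuousOn.comp continuousOn_snd fun z hz => hz.2).sub
      (hΓ.continuousOn.comp (continuous_fst.comp continuous_fst).continuousOn
        fun z hz => hz.1.1)
  have h2 : ContinuousOn (fun z : (ℝ × (Fin (d - 1) → ℝ)) × ℝ => normalVec N z.1.1 z.1.2)
      ((Icc 0 ℓ ×ˢ univ) ×ˢ Icc 0 ℓ) :=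
    hN.continuousOn_normalVec.comp continuousOn_fst fun z hz => hz.1
  exact (h1.norm.pow 2).sub (continuousOn_const.mul (h1.inner h2))

/-- Near a parameter `s₀`, the excess is positive for all parameters close to `s₀`, as long as
the normal coordinates stay away from the focal set. -/
theorem IsSmoothJordanCurve.eventually_gap_pos_near (hΓ : IsSmoothJordanCurve Γ ℓ)
    (hN : IsNormalFrame Γ ℓ N) {s₀ : ℝ} (hs₀ : s₀ ∈ Icc 0 ℓ) {u₀ : Fin (d - 1) → ℝ}
    (hκ : principalCurvature Γ ℓ N s₀ ⬝ᵥ u₀ < 1) :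
    ∃ δ > 0, ∀ᶠ q in 𝓝[Icc 0 ℓ ×ˢ univ] (s₀, u₀), ∀ t ∈ Icc 0 ℓ, |t - s₀| < δ → t ≠ q.1 →
      0 < gap Γ N q.1 q.2 t := by
  set C := derivWithin (tangent Γ ℓ) (Icc 0 ℓ) s₀ with hC
  set c := 1 - principalCurvature Γ ℓ N s₀ ⬝ᵥ u₀ with hc
  have hc0 : 0 < c := sub_pos.2 hκ
  set M := ‖normalVec N s₀ u₀‖ + 1 with hM
  have hM0 : 0 < M := by positivity
  -- Error budget: the bound on ‖Γ t - Γ s‖², the drift of the curvature term and the Taylor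
  -- remainder each cost c/4 of the leading coefficient c, leaving c/4. The minimum with 1 keeps 1 -
  -- ε nonnegative for squaring.
  obtain ⟨δ₁, hδ₁, h1⟩ := hΓ.taylor_one hs₀ (ε := min (c / 8) 1) (by positivity)
  obtain ⟨δ₂, hδ₂, h2⟩ := hΓ.taylor_two hs₀ (ε := c / (8 * M)) (by positivity)
  have hmem : (s₀, u₀) ∈ Icc 0 ℓ ×ˢ (univ : Set (Fin (d - 1) → ℝ)) := ⟨hs₀, mem_univ _⟩
  have hcont : Tendsto (fun q : ℝ × (Fin (d - 1) → ℝ) => normalVec N q.1 q.2)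
      (𝓝[Icc 0 ℓ ×ˢ univ] (s₀, u₀)) (𝓝 (normalVec N s₀ u₀)) :=
    hN.continuousOn_normalVec _ hmem
  have e1 : ∀ᶠ q in 𝓝[Icc 0 ℓ ×ˢ univ] (s₀, u₀), ‖normalVec N q.1 q.2‖ < M :=
    hcont.norm.eventually_lt_const (by simp [hM])
  have e2 : ∀ᶠ q in 𝓝[Icc 0 ℓ ×ˢ univ] (s₀, u₀),
      inner ℝ C (normalVec N q.1 q.2) < 1 - c + c / 4 := by
    refine ((tendsto_const_nhds (x := C)).inner (𝕜 := ℝ) hcont).eventually_lt_const ?_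
    rw [hC, inner_derivWithin_tangent_normalVec]
    linarith
  have e3 : ∀ᶠ q : ℝ × (Fin (d - 1) → ℝ) in 𝓝[Icc 0 ℓ ×ˢ univ] (s₀, u₀),
      |q.1 - s₀| < min δ₁ δ₂ := by
    have : Continuous fun q : ℝ × (Fin (d - 1) → ℝ) => |q.1 - s₀| := by fun_prop
    refine nhdsWithin_le_nhds ((this.tendsto (s₀, u₀)).eventually_lt_const ?_)
    simp [hδ₁, hδ₂]
  refine ⟨min δ₁ δ₂, lt_min hδ₁ hδ₂, ?_⟩
  filter_upwards [e1, e2, e3, self_mem_nhdsWithin] with ⟨s, u⟩ e1 e2 e3 hq t ht htδ hts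
  have hs : s ∈ Icc 0 ℓ := hq.1
  simp only at e1 e2 e3 hts ⊢
  rw [lt_min_iff] at htδ e3
  have g1 := h1 s hs t ht e3.1 htδ.1
  have g2 := h2 s hs t ht e3.2 htδ.2
  rw [← hC] at g2
  set n := normalVec N s u with hn
  have h7 : 0 < (t - s) ^ 2 := by
    have := sub_ne_zero.2 hts
    positivity
  have f1 : (1 - min (c / 8) 1) * |t - s| ≤ ‖Γ t - Γ s‖ := by
    have := norm_sub_norm_le ((t - s) • tangent Γ ℓ s₀) (Γ t - Γ s)
    rw [norm_smul, hΓ.arcLength s₀ hs₀, Real.norm_eq_abs,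
      norm_sub_rev ((t - s) • tangent Γ ℓ s₀)] at this
    linarith
  have f2 : (1 - 2 * min (c / 8) 1) * (t - s) ^ 2 ≤ ‖Γ t - Γ s‖ ^ 2 := by
    have h0 : 0 ≤ (1 - min (c / 8) 1) * |t - s| :=
      mul_nonneg (sub_nonneg.2 (min_le_right _ _)) (abs_nonneg _)
    have := pow_le_pow_left₀ h0 f1 2
    rw [mul_pow, sq_abs] at this
    nlinarith [sq_nonneg (min (c / 8) 1)]
  have f3 : (1 - c / 4) * (t - s) ^ 2 ≤ ‖Γ t - Γ s‖ ^ 2 := by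
    refine le_trans ?_ f2
    gcongr
    linarith [min_le_left (c / 8) 1]
  -- The linear term uses the tangent at the moving base point s, so it is exactly orthogonal to n.
  have h5 := (abs_le.1 (abs_real_inner_le_norm (Γ t - Γ s - (t - s) • tangent Γ ℓ s -
        ((t - s) ^ 2 / 2) • C) n)).2
  rw [inner_sub_left, inner_sub_left, inner_smul_left, inner_smul_left,
    hN.inner_tangent_normalVec hs] at h5
  simp only [conj_trivial] at h5
  have h8 : ‖Γ t - Γ s - (t - s) • tangent Γ ℓ s - ((t - s) ^ 2 / 2) • C‖ * ‖n‖ ≤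
      c / 8 * (t - s) ^ 2 := by
    calc _ ≤ (c / (8 * M) * (t - s) ^ 2) * M :=
          mul_le_mul g2 e1.le (norm_nonneg _) (by positivity)
      _ = c / 8 * (t - s) ^ 2 := by field_simp
  have h9 := mul_lt_mul_of_pos_right e2 h7
  have h10 := mul_pos hc0 h7
  unfold gap
  rw [← hn]
  linarith

/-- Parameters t near s₀ are handled by the Taylor estimate, where the excess degenerates at t = s;
the others form a compact set, on which positivity persists by continuity. -/
theorem IsSmoothJordanCurve.eventually_mem_normalRegion (hΓ : IsSmoothJordanCurve Γ ℓ)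
    (hN : IsNormalFrame Γ ℓ N) {s₀ : ℝ} (hs₀ : s₀ ∈ Icc 0 ℓ) {u₀ : Fin (d - 1) → ℝ}
    (hu₀ : u₀ ∈ normalRegion Γ ℓ N s₀) (hκ : principalCurvature Γ ℓ N s₀ ⬝ᵥ u₀ < 1) :
    ∀ᶠ q in 𝓝[Icc 0 ℓ ×ˢ univ] (s₀, u₀), q.2 ∈ normalRegion Γ ℓ N q.1 := by
  obtain ⟨δ, hδ, hnear⟩ := hΓ.eventually_gap_pos_near hN hs₀ hκ
  have hK : IsCompact (Icc 0 ℓ ∩ {t | δ ≤ |t - s₀|}) :=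
    isCompact_Icc.inter_right (isClosed_le continuous_const (by fun_prop))
  have hfar : ∀ᶠ q in 𝓝 (s₀, u₀), ∀ t ∈ Icc 0 ℓ ∩ {t | δ ≤ |t - s₀|},
      q ∈ Icc 0 ℓ ×ˢ univ → t ∈ Icc 0 ℓ → 0 < gap Γ N q.1 q.2 t := by
    refine hK.eventually_forall_of_forall_eventually fun t ht => ?_
    have hmem : ((s₀, u₀), t) ∈ (Icc 0 ℓ ×ˢ (univ : Set (Fin (d - 1) → ℝ))) ×ˢ Icc 0 ℓ :=
      ⟨⟨hs₀, mem_univ _⟩, ht.1⟩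
    have hts : t ≠ s₀ := by
      rintro rfl
      exact absurd ht.2 (by simpa using hδ)
    have := (hΓ.continuousOn_gap hN _ hmem).eventually_const_lt
      ((hΓ.mem_normalRegion_iff hs₀).1 hu₀ t ht.1 hts)
    rw [eventually_nhdsWithin_iff] at this
    filter_upwards [this] with z hz h1 h2
    exact hz ⟨h1, h2⟩
  filter_upwards [hnear, nhdsWithin_le_nhds hfar, self_mem_nhdsWithin] with q h1 h2 hq
  rw [hΓ.mem_normalRegion_iff hq.1]
  intro t ht hts
  rcases lt_or_ge |t - s₀| δ with h | h
  · exact h1 t ht h hts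
  · exact h2 t ⟨ht, h⟩ hq ht

theorem IsSmoothJordanCurve.normalRegion_mem_nhds_zero (hΓ : IsSmoothJordanCurve Γ ℓ)
    (hN : IsNormalFrame Γ ℓ N) {s : ℝ} (hs : s ∈ Icc 0 ℓ) :
    normalRegion Γ ℓ N s ∈ 𝓝 0 := by
  have h0 : (0 : Fin (d - 1) → ℝ) ∈ normalRegion Γ ℓ N s := by
    rw [hΓ.mem_normalRegion_iff hs]
    intro t ht hts
    have : Γ t - Γ s ≠ 0 := sub_ne_zero.2 fun h => hts (hΓ.injOn ht hs h)
    have h2 : 0 < ‖Γ t - Γ s‖ ^ 2 := by positivity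
    simpa [gap, normalVec] using h2
  have h := hΓ.eventually_mem_normalRegion hN hs h0 (by simp)
  have h1 : Tendsto (fun u : Fin (d - 1) → ℝ => (s, u)) (𝓝 0)
      (𝓝[Icc 0 ℓ ×ˢ univ] (s, (0 : Fin (d - 1) → ℝ))) := by
    refine tendsto_nhdsWithin_iff.2 ⟨?_, .of_forall fun u => ⟨hs, mem_univ _⟩⟩
    exact (by fun_prop : Continuous fun u : Fin (d - 1) → ℝ => (s, u)).tendsto 0
  exact h1.eventually h

/-- The normal regions vary continuously, up to null sets. -/
theorem IsSmoothJordanCurve.ae_eventually_mem_normalRegion_iff (hΓ : IsSmoothJordanCurve Γ ℓ)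
    (hN : IsNormalFrame Γ ℓ N) {s₀ : ℝ} (hs₀ : s₀ ∈ Icc 0 ℓ) :
    ∀ᵐ u : Fin (d - 1) → ℝ, ∀ᶠ s in 𝓝[Icc 0 ℓ] s₀,
      (u ∈ normalRegion Γ ℓ N s ↔ u ∈ normalRegion Γ ℓ N s₀) := by
  have hfr : volume (frontier (closedNormalRegion Γ ℓ N s₀)) = 0 :=
    (convex_closedNormalRegion s₀).addHaar_frontier volume
  have hpair : ∀ u : Fin (d - 1) → ℝ, Tendsto (fun s => (s, u)) (𝓝[Icc 0 ℓ] s₀)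
      (𝓝[Icc 0 ℓ ×ˢ univ] (s₀, u)) := by
    intro u
    refine tendsto_nhdsWithin_iff.2 ⟨?_, ?_⟩
    · exact ((by fun_prop : Continuous fun s : ℝ => (s, u)).tendsto s₀).mono_left
        nhdsWithin_le_nhds
    · filter_upwards [self_mem_nhdsWithin] with s hs using ⟨hs, mem_univ _⟩
  filter_upwards [measure_eq_zero_iff_ae_notMem.1 hfr] with u hu
  by_cases hK : u ∈ closedNormalRegion Γ ℓ N s₀
  · have hint : u ∈ interior (closedNormalRegion Γ ℓ N s₀) := by
      by_contra h
      exact hu ⟨subset_closure hK, h⟩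
    -- An interior point can be dilated slightly. Weak inequalities at c • u become strict at u,
    -- both for the excess (positive at 0 when t ≠ s₀) and for κ·u ≤ 1.
    obtain ⟨c, hcK, hc1⟩ : ∃ c : ℝ, c • u ∈ closedNormalRegion Γ ℓ N s₀ ∧ 1 < c := by
      have : Tendsto (fun c : ℝ => c • u) (𝓝[>] 1) (𝓝 u) := by
        have := (by fun_prop : Continuous fun c : ℝ => c • u).tendsto 1
        rw [one_smul] at this
        exact this.mono_left nhdsWithin_le_nhds
      have h1 := this.eventually (mem_interior_iff_mem_nhds.1 hint)
      exact (h1.and self_mem_nhdsWithin).exists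
    have hmem : u ∈ normalRegion Γ ℓ N s₀ := by
      rw [hΓ.mem_normalRegion_iff hs₀]
      intro t ht hts
      have h1 := hcK t ht
      have h2 : 0 < ‖Γ t - Γ s₀‖ ^ 2 := by
        have : Γ t - Γ s₀ ≠ 0 := sub_ne_zero.2 fun h => hts (hΓ.injOn ht hs₀ h)
        positivity
      simp only [gap, normalVec_smul, inner_smul_right] at h1 ⊢
      rcases le_or_gt (inner ℝ (Γ t - Γ s₀) (normalVec N s₀ u)) 0 with h | h
      · linarith
      · nlinarith
    have hκ : principalCurvature Γ ℓ N s₀ ⬝ᵥ u < 1 := by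
      have h1 := hΓ.dotProduct_le_one hN hs₀ hcK
      rw [dotProduct_smul, smul_eq_mul] at h1
      by_contra! h
      nlinarith
    have := (hpair u).eventually (hΓ.eventually_mem_normalRegion hN hs₀ hmem hκ)
    filter_upwards [this] with s hs
    exact iff_of_true hs hmem
  · have hnot : u ∉ normalRegion Γ ℓ N s₀ := fun h => hK (hΓ.normalRegion_subset hs₀ h)
    obtain ⟨t, ht, hneg⟩ : ∃ t ∈ Icc 0 ℓ, gap Γ N s₀ u t < 0 := by
      by_contra! h
      exact hK h
    have hcont : ContinuousOn (fun q : ℝ × (Fin (d - 1) → ℝ) => gap Γ N q.1 q.2 t)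
        (Icc 0 ℓ ×ˢ univ) :=
      (hΓ.continuousOn_gap hN).comp (f := fun q : ℝ × (Fin (d - 1) → ℝ) => (q, t))
        (by fun_prop) fun q hq => ⟨hq, ht⟩
    have h1 := (hcont (s₀, u) ⟨hs₀, mem_univ _⟩).eventually_lt_const hneg
    filter_upwards [(hpair u).eventually h1, self_mem_nhdsWithin] with s hs hsI
    refine iff_of_false (fun h => ?_) hnot
    exact absurd (hΓ.normalRegion_subset hsI h t ht) (not_le.2 hs)

end Openness

/-! ### Transverse moments, the Gram matrix and their continuity -/

section Moments

open Topology Filter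

variable {d : ℕ} {Γ : ℝ → E d} {ℓ : ℝ} {N : Fin (d - 1) → ℝ → E d} {p : E d → ℝ} {C ρ : ℝ}

/-- Regularity of a density along the normal coordinates of a curve: it is measurable and bounded,
and its support is bounded in normal coordinates. -/
structure IsBoundedAlong (p : E d → ℝ) (Γ : ℝ → E d) (ℓ : ℝ) (N : Fin (d - 1) → ℝ → E d)
    (C ρ : ℝ) : Prop where
  measurable : Measurable p
  nonneg : ∀ x, 0 ≤ p x
  le : ∀ x, p x ≤ C
  norm_le : ∀ s ∈ Icc 0 ℓ, ∀ u, p (normalMap Γ N (s, u)) ≠ 0 → ‖u‖ ≤ ρ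

theorem IsNormalFrame.norm_le_norm_normalVec (hN : IsNormalFrame Γ ℓ N) {s : ℝ}
    (hs : s ∈ Icc 0 ℓ) (u : Fin (d - 1) → ℝ) : ‖u‖ ≤ ‖normalVec N s u‖ := by
  refine (pi_norm_le_iff_of_nonneg (norm_nonneg _)).2 fun i => ?_
  rw [← hN.inner_normalVec_right hs u i]
  refine (norm_inner_le_norm _ _).trans ?_
  rw [(hN.orthonormal s hs).1 i, mul_one]

/-- Extracts what integration needs from a density continuous only on its compact support. The
radius is 2r, as both ν(s,u) and Γ(s) lie in the ball of radius r. -/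
theorem exists_isBoundedAlong {𝕏 : Set (E d)} (hp_nonneg : ∀ x, 0 ≤ p x)
    (hp_supp : tsupport p = 𝕏) (h𝕏 : IsCompact 𝕏) (hp : ContinuousOn p 𝕏)
    (hΓ𝕏 : MapsTo Γ (Icc 0 ℓ) 𝕏) (hN : IsNormalFrame Γ ℓ N) :
    ∃ C ρ, IsBoundedAlong p Γ ℓ N C ρ := by
  have hzero : ∀ x, x ∉ 𝕏 → p x = 0 := fun x hx =>
    image_eq_zero_of_notMem_tsupport (hp_supp ▸ hx)
  obtain ⟨C, hC⟩ := h𝕏.exists_bound_of_continuousOn hp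
  obtain ⟨r, hr⟩ := h𝕏.isBounded.exists_norm_le
  refine ⟨max C 0, r + r, ?_, hp_nonneg, fun x => ?_, fun s hs u hu => ?_⟩
  · classical
    have h1 : 𝕏.indicator p = p := indicator_eq_self.2 fun x hx => by
      by_contra h
      exact hx (hzero x h)
    rw [← h1, ← piecewise_eq_indicator]
    exact hp.measurable_piecewise continuousOn_const h𝕏.measurableSet
  · by_cases hx : x ∈ 𝕏
    · exact ((le_abs_self _).trans (hC x hx)).trans (le_max_left _ _)
    · rw [hzero x hx]
      exact le_max_right _ _
  · have hx : normalMap Γ N (s, u) ∈ 𝕏 := by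
      by_contra h
      exact hu (hzero _ h)
    refine (hN.norm_le_norm_normalVec hs u).trans ?_
    have : normalVec N s u = normalMap Γ N (s, u) - Γ s := by rw [normalMap_eq]; abel
    rw [this]
    exact (norm_sub_le _ _).trans (add_le_add (hr _ hx) (hr _ (hΓ𝕏 hs)))

theorem continuous_normalMap (s : ℝ) : Continuous fun u => normalMap Γ N (s, u) := by
  simp only [normalMap_eq]
  exact continuous_const.add (continuous_normalVec s)

theorem IsSmoothJordanCurve.measurableSet_normalRegion (hΓ : IsSmoothJordanCurve Γ ℓ) (s : ℝ) :
    MeasurableSet (normalRegion Γ ℓ N s) := by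
  have h := (continuous_normalMap (Γ := Γ) (N := N) s).measurable
  exact (h (hΓ.measurable_projIndex (measurableSet_singleton s))).inter
    (h hΓ.measurableSet_ambiguitySet.compl)

/-- The majorant does not depend on s, as dominated convergence in s requires. -/
theorem IsBoundedAlong.norm_mul_le (hp : IsBoundedAlong p Γ ℓ N C ρ)
    {f : (Fin (d - 1) → ℝ) → ℝ} {B : ℝ} (hB : ∀ u ∈ Metric.closedBall 0 ρ, ‖f u‖ ≤ B)
    {s : ℝ} (hs : s ∈ Icc 0 ℓ) (u : Fin (d - 1) → ℝ) :
    ‖f u * p (normalMap Γ N (s, u))‖ ≤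
      (Metric.closedBall (0 : Fin (d - 1) → ℝ) ρ).indicator (fun _ => B * C) u := by
  by_cases h : p (normalMap Γ N (s, u)) = 0
  · rw [h, mul_zero, norm_zero]
    refine indicator_nonneg (fun v hv => ?_) u
    exact mul_nonneg ((norm_nonneg _).trans (hB v hv)) ((hp.nonneg (Γ 0)).trans (hp.le _))
  · have hu : u ∈ Metric.closedBall (0 : Fin (d - 1) → ℝ) ρ := by
      simpa using hp.norm_le s hs u h
    rw [indicator_of_mem hu, norm_mul, Real.norm_of_nonneg (hp.nonneg _)]
    exact mul_le_mul (hB u hu) (hp.le _) (hp.nonneg _) ((norm_nonneg _).trans (hB u hu))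

theorem integrable_indicator_closedBall (ρ B : ℝ) :
    Integrable ((Metric.closedBall (0 : Fin (d - 1) → ℝ) ρ).indicator (fun _ => B)) := by
  rw [integrable_indicator_iff Metric.isClosed_closedBall.measurableSet]
  exact integrableOn_const (measure_closedBall_lt_top.ne)

theorem exists_bound_closedBall {f : (Fin (d - 1) → ℝ) → ℝ} (hf : Continuous f) (ρ : ℝ) :
    ∃ B, ∀ u ∈ Metric.closedBall (0 : Fin (d - 1) → ℝ) ρ, ‖f u‖ ≤ B :=
  (isCompact_closedBall _ _).exists_bound_of_continuousOn hf.continuousOn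

theorem IsBoundedAlong.integrable_mul (hp : IsBoundedAlong p Γ ℓ N C ρ)
    {f : (Fin (d - 1) → ℝ) → ℝ} (hf : Continuous f) {s : ℝ} (hs : s ∈ Icc 0 ℓ) :
    Integrable fun u => f u * p (normalMap Γ N (s, u)) := by
  obtain ⟨B, hB⟩ := exists_bound_closedBall hf ρ
  refine (integrable_indicator_closedBall ρ (B * C)).mono' ?_
    (.of_forall fun u => hp.norm_mul_le hB hs u)
  exact (hf.measurable.mul
    (hp.measurable.comp (continuous_normalMap s).measurable)).aestronglyMeasurable

theorem momentVector_apply (s : ℝ) (i : Fin (d - 1)) :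
    momentVector p Γ ℓ N s i =
      ∫ u in normalRegion Γ ℓ N s, u i * p (normalMap Γ N (s, u)) := by
  have h : ∀ u : Fin (d - 1) → ℝ, ∏ k, u k ^ (Pi.single i 1 : Fin (d - 1) → ℕ) k = u i := by
    intro u
    rw [Finset.prod_eq_single i] <;> simp +contextual
  simp only [momentVector, transverseMoment, h]

theorem gramMatrix_apply (s : ℝ) (i k : Fin (d - 1)) :
    gramMatrix p Γ ℓ N s i k =
      ∫ u in normalRegion Γ ℓ N s, (u i * u k) * p (normalMap Γ N (s, u)) := by
  have h : ∀ (i : Fin (d - 1)) (u : Fin (d - 1) → ℝ),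
      ∏ k, u k ^ (Pi.single i 1 : Fin (d - 1) → ℕ) k = u i := by
    intro i u
    rw [Finset.prod_eq_single i] <;> simp +contextual
  simp only [gramMatrix, transverseMoment, Matrix.of_apply, Pi.add_apply, pow_add,
    Finset.prod_mul_distrib, h]

theorem transverseMoment_zero (s : ℝ) :
    transverseMoment p Γ ℓ N 0 s =
      ∫ u in normalRegion Γ ℓ N s, p (normalMap Γ N (s, u)) := by
  simp [transverseMoment]

theorem IsBoundedAlong.gramMatrix_mulVec (hp : IsBoundedAlong p Γ ℓ N C ρ)
    {s : ℝ} (hs : s ∈ Icc 0 ℓ) (v : Fin (d - 1) → ℝ) (i : Fin (d - 1)) :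
    (gramMatrix p Γ ℓ N s).mulVec v i =
      ∫ u in normalRegion Γ ℓ N s, (u i * (v ⬝ᵥ u)) * p (normalMap Γ N (s, u)) := by
  have h : ∀ u : Fin (d - 1) → ℝ, (u i * (v ⬝ᵥ u)) * p (normalMap Γ N (s, u)) =
      ∑ k, (u i * u k * p (normalMap Γ N (s, u))) * v k := by
    intro u
    rw [dotProduct, Finset.mul_sum, Finset.sum_mul]
    exact Finset.sum_congr rfl fun k _ => by ring
  simp only [h]
  rw [integral_finsetSum]
  · simp only [Matrix.mulVec, dotProduct, gramMatrix_apply]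
    exact Finset.sum_congr rfl fun k _ => (integral_mul_const _ _).symm
  · intro k _
    exact ((hp.integrable_mul (f := fun u => u i * u k) (by fun_prop) hs).integrableOn).mul_const _

theorem IsBoundedAlong.dotProduct_gramMatrix (hp : IsBoundedAlong p Γ ℓ N C ρ)
    {s : ℝ} (hs : s ∈ Icc 0 ℓ) (v : Fin (d - 1) → ℝ) :
    v ⬝ᵥ (gramMatrix p Γ ℓ N s).mulVec v =
      ∫ u in normalRegion Γ ℓ N s, (v ⬝ᵥ u) ^ 2 * p (normalMap Γ N (s, u)) := by
  have h : ∀ u : Fin (d - 1) → ℝ, (v ⬝ᵥ u) ^ 2 * p (normalMap Γ N (s, u)) =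
      ∑ k, v k * (u k * (v ⬝ᵥ u) * p (normalMap Γ N (s, u))) := by
    intro u
    rw [sq]
    nth_rw 1 [dotProduct]
    rw [Finset.sum_mul, Finset.sum_mul]
    exact Finset.sum_congr rfl fun k _ => by ring
  simp only [h]
  rw [integral_finsetSum]
  · simp only [dotProduct, hp.gramMatrix_mulVec hs]
    exact Finset.sum_congr rfl fun k _ => (integral_const_mul _ _).symm
  · intro k _
    refine Integrable.const_mul (hp.integrable_mul (f := fun u => u k * (v ⬝ᵥ u)) ?_ hs).integrableOn _
    unfold dotProduct
    fun_prop

theorem volume_dotProduct_eq_zero {v : Fin (d - 1) → ℝ} (hv : v ≠ 0) :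
    volume {u : Fin (d - 1) → ℝ | v ⬝ᵥ u = 0} = 0 := by
  refine Measure.addHaar_submodule volume (LinearMap.ker (dotProductBilin ℝ ℝ v)) fun h => hv ?_
  have h1 : v ∈ LinearMap.ker (dotProductBilin ℝ ℝ v) := h ▸ Submodule.mem_top
  exact dotProduct_self_eq_zero.1 h1

/-- A nonnegative integrand with zero integral vanishes almost everywhere, and the factor (v·u)² is
zero only on a null hyperplane. -/
theorem IsBoundedAlong.ae_eq_zero_of_integral_sq (hp : IsBoundedAlong p Γ ℓ N C ρ)
    {s : ℝ} (hs : s ∈ Icc 0 ℓ) {v : Fin (d - 1) → ℝ} (hv : v ≠ 0)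
    (h : ∫ u in normalRegion Γ ℓ N s, (v ⬝ᵥ u) ^ 2 * p (normalMap Γ N (s, u)) = 0) :
    ∀ᵐ u ∂(volume.restrict (normalRegion Γ ℓ N s)), p (normalMap Γ N (s, u)) = 0 := by
  have hint : IntegrableOn (fun u => (v ⬝ᵥ u) ^ 2 * p (normalMap Γ N (s, u)))
      (normalRegion Γ ℓ N s) := by
    refine (hp.integrable_mul (f := fun u => (v ⬝ᵥ u) ^ 2) ?_ hs).integrableOn
    unfold dotProduct
    fun_prop
  rw [integral_eq_zero_iff_of_nonneg (fun u => mul_nonneg (sq_nonneg _) (hp.nonneg _)) hint] at h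
  have h1 := ae_restrict_of_ae (s := normalRegion Γ ℓ N s)
    (measure_eq_zero_iff_ae_notMem.1 (volume_dotProduct_eq_zero hv))
  filter_upwards [h, h1] with u hu hu1
  have hne : (v ⬝ᵥ u) ^ 2 ≠ 0 := pow_ne_zero 2 hu1
  exact (mul_eq_zero.1 hu).resolve_left hne

theorem IsBoundedAlong.ae_eq_zero_of_transverseMoment_zero (hp : IsBoundedAlong p Γ ℓ N C ρ)
    {s : ℝ} (hs : s ∈ Icc 0 ℓ) (h : transverseMoment p Γ ℓ N 0 s = 0) :
    ∀ᵐ u ∂(volume.restrict (normalRegion Γ ℓ N s)), p (normalMap Γ N (s, u)) = 0 := by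
  have hint : IntegrableOn (fun u => p (normalMap Γ N (s, u))) (normalRegion Γ ℓ N s) := by
    simpa using (hp.integrable_mul (f := fun _ => 1) (by fun_prop) hs).integrableOn
  rw [transverseMoment_zero, integral_eq_zero_iff_of_nonneg (fun u => hp.nonneg _) hint] at h
  exact h

/-- On a slice without mass both sides are zero, whatever v is; such parameters impose no condition
on the curvature. -/
theorem IsBoundedAlong.moment_eq_of_transverseMoment_zero (hp : IsBoundedAlong p Γ ℓ N C ρ)
    {s : ℝ} (hs : s ∈ Icc 0 ℓ) (h : transverseMoment p Γ ℓ N 0 s = 0) (v : Fin (d - 1) → ℝ) :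
    momentVector p Γ ℓ N s = (gramMatrix p Γ ℓ N s).mulVec v := by
  have h0 := hp.ae_eq_zero_of_transverseMoment_zero hs h
  funext i
  rw [momentVector_apply, hp.gramMatrix_mulVec hs, integral_eq_zero_of_ae, integral_eq_zero_of_ae]
  · filter_upwards [h0] with u hu
    simp [hu]
  · filter_upwards [h0] with u hu
    simp [hu]

/-- The Gram matrix is invertible at parameters that carry mass. -/
theorem IsBoundedAlong.isUnit_gramMatrix (hp : IsBoundedAlong p Γ ℓ N C ρ)
    (hΓ : IsSmoothJordanCurve Γ ℓ) (hN : IsNormalFrame Γ ℓ N) {𝕏 : Set (E d)}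
    (hp_pos : ∀ x ∈ interior 𝕏, 0 < p x) {s : ℝ} (hs : s ∈ Icc 0 ℓ)
    (h : Γ s ∈ interior 𝕏 ∨ transverseMoment p Γ ℓ N 0 s ≠ 0) :
    IsUnit (gramMatrix p Γ ℓ N s) := by
  rw [Matrix.isUnit_iff_isUnit_det, isUnit_iff_ne_zero]
  intro hdet
  obtain ⟨v, hv, hGv⟩ := Matrix.exists_mulVec_eq_zero_iff.2 hdet
  have h0 := hp.dotProduct_gramMatrix hs v
  rw [hGv, dotProduct_zero] at h0
  have hae := hp.ae_eq_zero_of_integral_sq hs hv h0.symm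
  rcases h with h | h
  · rw [ae_restrict_iff' (hΓ.measurableSet_normalRegion s)] at hae
    -- Near u = 0 the density is positive and u lies in the region, which gives a set of positive
    -- measure where p should vanish.
    have h1 : ∀ᶠ u in 𝓝 (0 : Fin (d - 1) → ℝ), normalMap Γ N (s, u) ∈ interior 𝕏 := by
      refine (continuous_normalMap s).continuousAt.eventually
        (isOpen_interior.mem_nhds ?_)
      simpa [normalMap_eq, normalVec] using h
    have h2 := h1.and (hΓ.normalRegion_mem_nhds_zero hN hs)
    have h3 : volume {u : Fin (d - 1) → ℝ | normalMap Γ N (s, u) ∈ interior 𝕏 ∧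
        u ∈ normalRegion Γ ℓ N s} = 0 := by
      refine measure_mono_null (fun u hu => ?_) hae
      intro hu'
      exact (hp_pos _ hu.1).ne' (hu' hu.2)
    exact (Measure.measure_pos_of_mem_nhds volume h2).ne' h3
  · refine h ?_
    rw [transverseMoment_zero]
    exact integral_eq_zero_of_ae hae

/-- For a continuous density the weighted integrals over the normal regions are continuous. -/
theorem IsBoundedAlong.continuousOn_integral (hp : IsBoundedAlong p Γ ℓ N C ρ)
    (hΓ : IsSmoothJordanCurve Γ ℓ) (hN : IsNormalFrame Γ ℓ N) (hpc : Continuous p)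
    {f : (Fin (d - 1) → ℝ) → ℝ} (hf : Continuous f) :
    ContinuousOn (fun s => ∫ u in normalRegion Γ ℓ N s, f u * p (normalMap Γ N (s, u)))
      (Icc 0 ℓ) := by
  intro s₀ hs₀
  obtain ⟨B, hB⟩ := exists_bound_closedBall hf ρ
  simp only [ContinuousWithinAt, ← integral_indicator (hΓ.measurableSet_normalRegion _)]
  refine tendsto_integral_filter_of_dominated_convergence
    ((Metric.closedBall (0 : Fin (d - 1) → ℝ) ρ).indicator (fun _ => B * C)) ?_ ?_
    (integrable_indicator_closedBall ρ _) ?_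
  · refine .of_forall fun s => ?_
    exact (((hf.measurable.mul (hp.measurable.comp (continuous_normalMap s).measurable))).indicator
      (hΓ.measurableSet_normalRegion s)).aestronglyMeasurable
  · filter_upwards [self_mem_nhdsWithin] with s hs
    exact .of_forall fun u => (norm_indicator_le_norm_self _ _).trans (hp.norm_mul_le hB hs u)
  · filter_upwards [hΓ.ae_eventually_mem_normalRegion_iff hN hs₀] with u hu
    have hcont : ContinuousWithinAt (fun s => f u * p (normalMap Γ N (s, u))) (Icc 0 ℓ) s₀ := by
      have h1 : ContinuousOn (fun s => normalMap Γ N (s, u)) (Icc 0 ℓ) := by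
        simp only [normalMap_eq]
        exact hΓ.continuousOn.add (hN.continuousOn_normalVec.comp
          (f := fun s : ℝ => (s, u)) (by fun_prop) fun s hs => ⟨hs, mem_univ _⟩)
      exact (continuousOn_const.mul (hpc.comp_continuousOn h1)) s₀ hs₀
    by_cases hmem : u ∈ normalRegion Γ ℓ N s₀
    · rw [indicator_of_mem hmem]
      refine hcont.tendsto.congr' ?_
      filter_upwards [hu] with s hs
      rw [indicator_of_mem (hs.2 hmem)]
    · rw [indicator_of_notMem hmem]
      refine tendsto_const_nhds.congr' ?_
      filter_upwards [hu] with s hs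
      rw [indicator_of_notMem (fun h => hmem (hs.1 h))]

theorem IsBoundedAlong.continuousOn_momentVector (hp : IsBoundedAlong p Γ ℓ N C ρ)
    (hΓ : IsSmoothJordanCurve Γ ℓ) (hN : IsNormalFrame Γ ℓ N) (hpc : Continuous p) :
    ContinuousOn (momentVector p Γ ℓ N) (Icc 0 ℓ) := by
  refine continuousOn_pi.2 fun i => ?_
  simp only [momentVector_apply]
  exact hp.continuousOn_integral hΓ hN hpc (f := fun u => u i) (by fun_prop)

theorem IsSmoothJordanCurve.continuousOn_principalCurvature (hΓ : IsSmoothJordanCurve Γ ℓ)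
    (hN : IsNormalFrame Γ ℓ N) : ContinuousOn (principalCurvature Γ ℓ N) (Icc 0 ℓ) :=
  continuousOn_pi.2 fun i => hΓ.continuousOn_derivWithin_tangent.inner (hN.continuousOn i)

theorem IsBoundedAlong.continuousOn_gramMatrix_mulVec (hp : IsBoundedAlong p Γ ℓ N C ρ)
    (hΓ : IsSmoothJordanCurve Γ ℓ) (hN : IsNormalFrame Γ ℓ N) (hpc : Continuous p) :
    ContinuousOn (fun s => (gramMatrix p Γ ℓ N s).mulVec (principalCurvature Γ ℓ N s))
      (Icc 0 ℓ) := by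
  refine continuousOn_pi.2 fun i => ?_
  simp only [Matrix.mulVec, dotProduct, gramMatrix_apply]
  refine continuousOn_finsetSum _ fun k _ => ?_
  exact (hp.continuousOn_integral hΓ hN hpc (f := fun u => u i * u k) (by fun_prop)).mul
    (continuousOn_pi.1 (hΓ.continuousOn_principalCurvature hN) k)

/-- Functions continuous on `[0, ℓ]` that agree almost everywhere agree everywhere. -/
theorem eqOn_Icc_of_ae_eq {F : Type*} [TopologicalSpace F] [T2Space F] {f g : ℝ → F}
    (hℓ : 0 < ℓ) (hf : ContinuousOn f (Icc 0 ℓ)) (hg : ContinuousOn g (Icc 0 ℓ)) :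
    (∀ᵐ s ∂(volume.restrict (Icc 0 ℓ)), f s = g s) ↔ ∀ s ∈ Icc 0 ℓ, f s = g s := by
  constructor
  · intro h
    exact Measure.eqOn_Icc_of_ae_eq volume hℓ.ne h hf hg
  · exact ae_restrict_of_forall_mem measurableSet_Icc

end Moments

/-! ### Jacobian of the normal coordinates and change of variables -/

section ChangeOfVariables

variable {d : ℕ} {Γ : ℝ → E d} {ℓ : ℝ} {N : Fin (d - 1) → ℝ → E d}

instance isAddHaarMeasure_volume_prod (n : ℕ) :
    (volume : Measure (ℝ × (Fin n → ℝ))).IsAddHaarMeasure :=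
  inferInstanceAs ((volume : Measure ℝ).prod (volume : Measure (Fin n → ℝ))).IsAddHaarMeasure

/-- The frame at a parameter identifies `ℝ × ℝ^(d-1)` with `ℝ^d`, preserving volume. -/
theorem IsNormalFrame.exists_continuousLinearEquiv (hd : 1 ≤ d) (hΓ : IsSmoothJordanCurve Γ ℓ)
    (hN : IsNormalFrame Γ ℓ N) {s : ℝ} (hs : s ∈ Icc 0 ℓ) :
    ∃ e : (ℝ × (Fin (d - 1) → ℝ)) ≃L[ℝ] E d,
      (∀ q, e q = q.1 • tangent Γ ℓ s + normalVec N s q.2) ∧ MeasurePreserving e := by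
  -- The frame is an isometry only for the L² product norm; the passage from the sup norm product
  -- preserves volume.
  let L : WithLp 2 (ℝ × EuclideanSpace ℝ (Fin (d - 1))) →ₗᵢ[ℝ] E d :=
    { toFun := fun q => q.fst • tangent Γ ℓ s + normalVec N s q.snd.ofLp
      map_add' := fun x y => by
        simp only [WithLp.add_fst, WithLp.add_snd, WithLp.ofLp_add, normalVec_add]
        module
      map_smul' := fun c x => by
        simp only [WithLp.smul_fst, WithLp.smul_snd, WithLp.ofLp_smul, normalVec_smul,
          smul_eq_mul, RingHom.id_apply]
        module
      norm_map' := fun q => by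
        have h1 : ‖q.fst • tangent Γ ℓ s + normalVec N s q.snd.ofLp‖ ^ 2 = ‖q‖ ^ 2 := by
          rw [norm_add_sq_real, inner_smul_left, hN.inner_tangent_normalVec hs, norm_smul,
            hΓ.arcLength s hs, hN.norm_normalVec_sq hs, WithLp.prod_norm_sq_eq_of_L2,
            EuclideanSpace.norm_sq_eq]
          simp
        exact (sq_eq_sq₀ (norm_nonneg _) (norm_nonneg _)).1 h1 }
  have hrank : Module.finrank ℝ (WithLp 2 (ℝ × EuclideanSpace ℝ (Fin (d - 1)))) =
      Module.finrank ℝ (E d) := by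
    rw [(WithLp.linearEquiv 2 ℝ (ℝ × EuclideanSpace ℝ (Fin (d - 1)))).finrank_eq]
    simp
    omega
  let I := L.toLinearIsometryEquiv hrank
  let J : (ℝ × (Fin (d - 1) → ℝ)) ≃L[ℝ] WithLp 2 (ℝ × EuclideanSpace ℝ (Fin (d - 1))) :=
    ((ContinuousLinearEquiv.refl ℝ ℝ).prodCongr
      (EuclideanSpace.equiv (Fin (d - 1)) ℝ).symm).trans
        (WithLp.prodContinuousLinearEquiv 2 ℝ ℝ (EuclideanSpace ℝ (Fin (d - 1)))).symm
  have hJ : MeasurePreserving J :=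
    (WithLp.volume_preserving_toLp ℝ (EuclideanSpace ℝ (Fin (d - 1)))).comp
      ((MeasurePreserving.id volume).prod (PiLp.volume_preserving_toLp (Fin (d - 1))))
  exact ⟨J.trans I.toContinuousLinearEquiv, fun q => rfl, I.measurePreserving.comp hJ⟩

theorem abs_det_eq_one_of_measurePreserving {V : Type*} [NormedAddCommGroup V] [NormedSpace ℝ V]
    [FiniteDimensional ℝ V] [MeasureSpace V] [BorelSpace V]
    [(volume : Measure V).IsAddHaarMeasure] (e : V ≃L[ℝ] V) (he : MeasurePreserving e) :
    |LinearMap.det (e : V →ₗ[ℝ] V)| = 1 := by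
  have h1 := Measure.addHaar_image_continuousLinearEquiv volume e (Metric.closedBall (0 : V) 1)
  have h2 := he.measure_preimage (s := e '' Metric.closedBall (0 : V) 1)
    (e.toHomeomorph.isClosedMap _ Metric.isClosed_closedBall).measurableSet.nullMeasurableSet
  rw [e.injective.preimage_image] at h2
  rw [← h2] at h1
  have h3 : volume (Metric.closedBall (0 : V) 1) ≠ 0 :=
    (Metric.measure_closedBall_pos volume 0 one_pos).ne'
  have h4 : volume (Metric.closedBall (0 : V) 1) ≠ ⊤ := measure_closedBall_lt_top.ne
  have h5 : ENNReal.ofReal |LinearMap.det (e : V →ₗ[ℝ] V)| = 1 := by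
    rw [← ENNReal.mul_left_inj h3 h4, one_mul]
    exact h1.symm
  simpa using h5

theorem IsNormalFrame.hasDerivWithinAt (hN : IsNormalFrame Γ ℓ N) {s : ℝ} (hs : s ∈ Icc 0 ℓ)
    (i : Fin (d - 1)) :
    HasDerivWithinAt (N i) (derivWithin (N i) (Icc 0 ℓ) s) (Icc 0 ℓ) s :=
  ((hN.smooth i).differentiableOn (by simp) s hs).hasDerivWithinAt

/-- Differentiate ⟨T, Nᵢ⟩ = 0. -/
theorem IsNormalFrame.inner_tangent_derivWithin (hN : IsNormalFrame Γ ℓ N)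
    (hΓ : IsSmoothJordanCurve Γ ℓ) {s : ℝ} (hs : s ∈ Icc 0 ℓ) (i : Fin (d - 1)) :
    inner ℝ (tangent Γ ℓ s) (derivWithin (N i) (Icc 0 ℓ) s) =
      -principalCurvature Γ ℓ N s i := by
  have h1 := (hΓ.hasDerivWithinAt_tangent hs).inner ℝ (hN.hasDerivWithinAt hs i)
  have h2 : HasDerivWithinAt (fun t => inner ℝ (tangent Γ ℓ t) (N i t)) (0 : ℝ) (Icc 0 ℓ) s :=
    (hasDerivWithinAt_const s (Icc 0 ℓ) (0 : ℝ)).congr (fun t ht => hN.normal t ht i)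
      (hN.normal s hs i)
  have h3 := (hΓ.uniqueDiffOn s hs).eq_deriv _ h1 h2
  rw [principalCurvature]
  linarith

/-- The Jacobian determinant of the normal coordinate map. -/
theorem IsNormalFrame.exists_hasFDerivWithinAt_normalMap (hd : 1 ≤ d)
    (hΓ : IsSmoothJordanCurve Γ ℓ) (hN : IsNormalFrame Γ ℓ N)
    {e : (ℝ × (Fin (d - 1) → ℝ)) ≃L[ℝ] E d} (he : MeasurePreserving e)
    {q : ℝ × (Fin (d - 1) → ℝ)} (hq : q.1 ∈ Icc 0 ℓ) :
    ∃ D : (ℝ × (Fin (d - 1) → ℝ)) →L[ℝ] ℝ × (Fin (d - 1) → ℝ),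
      HasFDerivWithinAt (fun q => e.symm (normalMap Γ N q)) D (Icc 0 ℓ ×ˢ univ) q ∧
        |D.det| = |1 - principalCurvature Γ ℓ N q.1 ⬝ᵥ q.2| := by
  obtain ⟨s, u⟩ := q
  obtain ⟨f, hf, hfm⟩ := hN.exists_continuousLinearEquiv hd hΓ hq
  let N' : Fin (d - 1) → E d := fun i => derivWithin (N i) (Icc 0 ℓ) s
  let v := f.symm (∑ i, u i • N' i)
  have hmaps : MapsTo (Prod.fst : ℝ × (Fin (d - 1) → ℝ) → ℝ) (Icc 0 ℓ ×ˢ univ) (Icc 0 ℓ) :=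
    fun q hq => hq.1
  -- In the frame at s the derivative of ν is the identity plus a rank-one term in ds, a
  -- transvection with determinant 1 + v.1. Here v.1 = ⟨T, ∑ uᵢNᵢ'⟩ = -κ·u.
  let S : (ℝ × (Fin (d - 1) → ℝ)) →L[ℝ] ℝ × (Fin (d - 1) → ℝ) :=
    ContinuousLinearMap.id ℝ _ + (ContinuousLinearMap.fst ℝ ℝ (Fin (d - 1) → ℝ)).smulRight v
  have hder : HasFDerivWithinAt (normalMap Γ N) ((f : _ →L[ℝ] E d).comp S)
      (Icc 0 ℓ ×ˢ univ) (s, u) := by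
    have h1 : HasFDerivWithinAt (fun q : ℝ × (Fin (d - 1) → ℝ) => Γ q.1)
        ((ContinuousLinearMap.fst ℝ ℝ (Fin (d - 1) → ℝ)).smulRight (tangent Γ ℓ s))
        (Icc 0 ℓ ×ˢ univ) (s, u) := by
      have h := HasFDerivWithinAt.comp (t := Icc 0 ℓ) (g := Γ)
        (f := (Prod.fst : ℝ × (Fin (d - 1) → ℝ) → ℝ)) (s, u)
        (hΓ.hasDerivWithinAt hq).hasFDerivWithinAt hasFDerivWithinAt_fst hmaps
      refine h.congr_fderiv ?_
      ext <;> simp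
    have h2 : ∀ i, HasFDerivWithinAt (fun q : ℝ × (Fin (d - 1) → ℝ) => q.2 i • N i q.1)
        (u i • (ContinuousLinearMap.fst ℝ ℝ (Fin (d - 1) → ℝ)).smulRight (N' i) +
          ((ContinuousLinearMap.proj i).comp
            (ContinuousLinearMap.snd ℝ ℝ (Fin (d - 1) → ℝ))).smulRight (N i s))
        (Icc 0 ℓ ×ˢ univ) (s, u) := by
      intro i
      have h := HasFDerivWithinAt.comp (t := Icc 0 ℓ) (g := N i)
        (f := (Prod.fst : ℝ × (Fin (d - 1) → ℝ) → ℝ)) (s, u)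
        (hN.hasDerivWithinAt hq i).hasFDerivWithinAt hasFDerivWithinAt_fst hmaps
      have h' : HasFDerivWithinAt (fun q : ℝ × (Fin (d - 1) → ℝ) => q.2 i)
          ((ContinuousLinearMap.proj (R := ℝ) (φ := fun _ : Fin (d - 1) => ℝ) i).comp
            (ContinuousLinearMap.snd ℝ ℝ (Fin (d - 1) → ℝ))) (Icc 0 ℓ ×ˢ univ) (s, u) :=
        ((ContinuousLinearMap.proj (R := ℝ) (φ := fun _ : Fin (d - 1) => ℝ) i).comp
          (ContinuousLinearMap.snd ℝ ℝ (Fin (d - 1) → ℝ))).hasFDerivWithinAt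
      refine (h'.smul h).congr_fderiv ?_
      ext <;> simp [N']
    refine (h1.add (HasFDerivWithinAt.fun_sum fun i (_ : i ∈ Finset.univ) => h2 i)).congr_fderiv ?_
    refine ContinuousLinearMap.ext fun q => ?_
    have hfv : f v = ∑ i, u i • N' i := f.apply_symm_apply _
    simp only [_root_.add_apply, ContinuousLinearMap.smulRight_apply,
      ContinuousLinearMap.coe_fst', _root_.sum_apply, _root_.smul_apply,
      ContinuousLinearMap.comp_apply, ContinuousLinearMap.coe_snd', ContinuousLinearMap.proj_apply,
      ContinuousLinearEquiv.coe_coe, S, ContinuousLinearMap.id_apply, map_add, map_smul, hfv, hf,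
      Finset.sum_add_distrib, normalVec, Finset.smul_sum]
    simp only [smul_comm q.1]
    abel
  refine ⟨(e.symm : E d →L[ℝ] ℝ × (Fin (d - 1) → ℝ)).comp ((f : _ →L[ℝ] E d).comp S),
    (e.symm : E d →L[ℝ] ℝ × (Fin (d - 1) → ℝ)).hasFDerivAt.comp_hasFDerivWithinAt _ hder, ?_⟩
  have hv1 : v.1 = -(principalCurvature Γ ℓ N s ⬝ᵥ u) := by
    have h1 : inner ℝ (tangent Γ ℓ s) (f v) = v.1 := by
      rw [hf, inner_add_right, inner_smul_right, hN.inner_tangent_normalVec hq,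
        real_inner_self_eq_norm_sq, hΓ.arcLength s hq]
      simp
    rw [← h1, f.apply_symm_apply, inner_sum]
    simp only [inner_smul_right, N', hN.inner_tangent_derivWithin hΓ hq, dotProduct,
      mul_neg, Finset.sum_neg_distrib, mul_comm]
  have hS : LinearMap.det (S : (ℝ × (Fin (d - 1) → ℝ)) →ₗ[ℝ] ℝ × (Fin (d - 1) → ℝ)) =
      1 - principalCurvature Γ ℓ N s ⬝ᵥ u := by
    have : (S : (ℝ × (Fin (d - 1) → ℝ)) →ₗ[ℝ] ℝ × (Fin (d - 1) → ℝ)) =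
        LinearMap.transvection (LinearMap.fst ℝ ℝ (Fin (d - 1) → ℝ)) v := rfl
    rw [this, LinearMap.transvection.det, LinearMap.fst_apply, hv1]
    ring
  -- The frames f and e may differ, but the passage between them preserves volume and does not
  -- affect |det|.
  have hfe : MeasurePreserving (f.trans e.symm) := by
    have : MeasurePreserving e.symm :=
      MeasurePreserving.symm e.toHomeomorph.toMeasurableEquiv he
    exact this.comp hfm
  have h1 := abs_det_eq_one_of_measurePreserving _ hfe
  have h2 : ((e.symm : E d →L[ℝ] ℝ × (Fin (d - 1) → ℝ)).comp ((f : _ →L[ℝ] E d).comp S)).det =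
      LinearMap.det ((f.trans e.symm : (ℝ × (Fin (d - 1) → ℝ)) ≃L[ℝ] _) :
        (ℝ × (Fin (d - 1) → ℝ)) →ₗ[ℝ] ℝ × (Fin (d - 1) → ℝ)) *
      LinearMap.det (S : (ℝ × (Fin (d - 1) → ℝ)) →ₗ[ℝ] ℝ × (Fin (d - 1) → ℝ)) := by
    rw [← LinearMap.det_comp]
    rfl
  rw [h2, abs_mul, h1, one_mul, hS]

/-- The normal coordinates of the unambiguous points of `𝕏`. -/
def normalDomain (Γ : ℝ → E d) (ℓ : ℝ) (N : Fin (d - 1) → ℝ → E d) (𝕏 : Set (E d)) :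
    Set (ℝ × (Fin (d - 1) → ℝ)) :=
  {q | q.1 ∈ Icc 0 ℓ ∧ q.2 ∈ normalRegion Γ ℓ N q.1 ∧ normalMap Γ N q ∈ 𝕏}

theorem IsSmoothJordanCurve.continuousOn_normalMap (hΓ : IsSmoothJordanCurve Γ ℓ)
    (hN : IsNormalFrame Γ ℓ N) : ContinuousOn (normalMap Γ N) (Icc 0 ℓ ×ˢ univ) :=
  (hΓ.continuousOn.comp continuousOn_fst fun _ hq => hq.1).add hN.continuousOn_normalVec

theorem IsSmoothJordanCurve.measurableSet_normalDomain (hΓ : IsSmoothJordanCurve Γ ℓ)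
    (hN : IsNormalFrame Γ ℓ N) {𝕏 : Set (E d)} (h𝕏 : MeasurableSet 𝕏) :
    MeasurableSet (normalDomain Γ ℓ N 𝕏) := by
  classical
  have hI : MeasurableSet (Icc 0 ℓ ×ˢ (univ : Set (Fin (d - 1) → ℝ))) :=
    measurableSet_Icc.prod .univ
  -- Γ and N are arbitrary outside [0, ℓ], so ν is replaced there by a constant to make it Borel.
  let M := (Icc 0 ℓ ×ˢ (univ : Set (Fin (d - 1) → ℝ))).piecewise (normalMap Γ N) fun _ => 0
  have hM : Measurable M :=
    (hΓ.continuousOn_normalMap hN).measurable_piecewise continuousOn_const hI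
  have hMeq : ∀ q ∈ Icc 0 ℓ ×ˢ (univ : Set (Fin (d - 1) → ℝ)), M q = normalMap Γ N q :=
    fun q hq => piecewise_eq_of_mem _ _ _ hq
  have : normalDomain Γ ℓ N 𝕏 = (Icc 0 ℓ ×ˢ univ) ∩ ({q | projIndex Γ ℓ (M q) = q.1} ∩
      (M ⁻¹' (ambiguitySet Γ ℓ)ᶜ ∩ M ⁻¹' 𝕏)) := by
    ext q
    constructor
    · rintro ⟨h1, ⟨h2, h3⟩, h4⟩
      have hq : q ∈ Icc 0 ℓ ×ˢ (univ : Set (Fin (d - 1) → ℝ)) := ⟨h1, mem_univ _⟩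
      refine ⟨hq, ?_, ?_, ?_⟩
      · rw [mem_ofPred_eq, hMeq q hq]; exact h2
      · rw [mem_preimage, hMeq q hq]; exact h3
      · rw [mem_preimage, hMeq q hq]; exact h4
    · rintro ⟨hq, h2, h3, h4⟩
      rw [mem_ofPred_eq, hMeq q hq] at h2
      rw [mem_preimage, hMeq q hq] at h3 h4
      exact ⟨hq.1, ⟨h2, h3⟩, h4⟩
  rw [this]
  exact hI.inter ((measurableSet_eq_fun (hΓ.measurable_projIndex.comp hM) measurable_fst).inter
    ((hM hΓ.measurableSet_ambiguitySet.compl).inter (hM h𝕏)))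

theorem IsNormalFrame.normalTransform_normalMap (hN : IsNormalFrame Γ ℓ N) {𝕏 : Set (E d)}
    {q : ℝ × (Fin (d - 1) → ℝ)} (hq : q ∈ normalDomain Γ ℓ N 𝕏) :
    normalTransform Γ ℓ N (normalMap Γ N q) = q := by
  obtain ⟨s, u⟩ := q
  obtain ⟨h1, ⟨h2, -⟩, -⟩ := hq
  simp only at h2 h1
  refine Prod.ext h2 (funext fun i => ?_)
  simp only [normalTransform, proj, h2]
  rw [normalMap_eq, add_sub_cancel_left, hN.inner_normalVec_right h1]

theorem IsSmoothJordanCurve.image_normalDomain (hΓ : IsSmoothJordanCurve Γ ℓ) {𝕏 : Set (E d)}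
    (hν : IsNormalDiffeo Γ ℓ N 𝕏) :
    normalMap Γ N '' normalDomain Γ ℓ N 𝕏 = 𝕏 \ ambiguitySet Γ ℓ := by
  ext x
  constructor
  · rintro ⟨q, ⟨-, ⟨-, h2⟩, h3⟩, rfl⟩
    exact ⟨h3, h2⟩
  · rintro ⟨hx, hxA⟩
    have h := hν.leftInv x ⟨⟨hΓ.projIndex_mem x, hx⟩, hxA⟩
    refine ⟨_, ⟨hΓ.projIndex_mem x, ⟨?_, ?_⟩, ?_⟩, h⟩
    · change projIndex Γ ℓ (normalMap Γ N (normalTransform Γ ℓ N x)) = projIndex Γ ℓ x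
      rw [h]
    · change normalMap Γ N (normalTransform Γ ℓ N x) ∉ ambiguitySet Γ ℓ
      rwa [h]
    · rwa [h]

theorem IsSmoothJordanCurve.abs_one_sub_dotProduct (hΓ : IsSmoothJordanCurve Γ ℓ)
    (hN : IsNormalFrame Γ ℓ N) {𝕏 : Set (E d)} {q : ℝ × (Fin (d - 1) → ℝ)}
    (hq : q ∈ normalDomain Γ ℓ N 𝕏) :
    |1 - principalCurvature Γ ℓ N q.1 ⬝ᵥ q.2| = 1 - principalCurvature Γ ℓ N q.1 ⬝ᵥ q.2 :=
  abs_of_nonneg <| sub_nonneg.2 <|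
    hΓ.dotProduct_le_one hN hq.1 (hΓ.normalRegion_subset hq.1 hq.2.1)

/-- Change to normal coordinates in an integral over `𝕏`. -/
theorem IsSmoothJordanCurve.integral_eq_integral_normalDomain (hd : 1 ≤ d)
    (hΓ : IsSmoothJordanCurve Γ ℓ) (hN : IsNormalFrame Γ ℓ N) {𝕏 : Set (E d)}
    (h𝕏 : MeasurableSet 𝕏) (hν : IsNormalDiffeo Γ ℓ N 𝕏) {F : Type*} [NormedAddCommGroup F]
    [NormedSpace ℝ F] {g : E d → F} (hg : Integrable g) (hg0 : ∀ x ∉ 𝕏, g x = 0) :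
    IntegrableOn (fun q => (1 - principalCurvature Γ ℓ N q.1 ⬝ᵥ q.2) • g (normalMap Γ N q))
        (normalDomain Γ ℓ N 𝕏) ∧
      ∫ x, g x = ∫ q in normalDomain Γ ℓ N 𝕏,
        (1 - principalCurvature Γ ℓ N q.1 ⬝ᵥ q.2) • g (normalMap Γ N q) := by
  -- Composing ν with one fixed volume-preserving identification makes it a map of ℝ × ℝ^(d-1) into
  -- itself, so that a determinant is defined. The frame at parameter 0 serves.
  obtain ⟨e, -, he⟩ := hN.exists_continuousLinearEquiv hd hΓ hΓ.zero_mem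
  have hDm := hΓ.measurableSet_normalDomain hN h𝕏
  have hsub : normalDomain Γ ℓ N 𝕏 ⊆ Icc 0 ℓ ×ˢ univ := fun q hq => ⟨hq.1, mem_univ _⟩
  choose! D hD hdet using fun (q : ℝ × (Fin (d - 1) → ℝ)) (hq : q.1 ∈ Icc 0 ℓ) =>
    hN.exists_hasFDerivWithinAt_normalMap hd hΓ he hq
  have hD' : ∀ q ∈ normalDomain Γ ℓ N 𝕏, HasFDerivWithinAt
      (fun q => e.symm (normalMap Γ N q)) (D q) (normalDomain Γ ℓ N 𝕏) q :=
    fun q hq => (hD q hq.1).mono hsub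
  have hinj : InjOn (fun q => e.symm (normalMap Γ N q)) (normalDomain Γ ℓ N 𝕏) := by
    intro q hq q' hq' h
    have h1 : normalMap Γ N q = normalMap Γ N q' := e.symm.injective h
    rw [← hN.normalTransform_normalMap hq, h1, hN.normalTransform_normalMap hq']
  have himage : (fun q => e.symm (normalMap Γ N q)) '' normalDomain Γ ℓ N 𝕏 =
      e ⁻¹' (𝕏 \ ambiguitySet Γ ℓ) := by
    rw [← hΓ.image_normalDomain hν]
    ext y
    constructor
    · rintro ⟨q, hq, rfl⟩
      exact ⟨q, hq, by simp⟩
    · rintro ⟨q, hq, h⟩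
      exact ⟨q, hq, by simp [h]⟩
  have hemb : MeasurableEmbedding e := e.toHomeomorph.measurableEmbedding
  have hcongr : EqOn (fun q => |(D q).det| • g (e (e.symm (normalMap Γ N q))))
      (fun q => (1 - principalCurvature Γ ℓ N q.1 ⬝ᵥ q.2) • g (normalMap Γ N q))
      (normalDomain Γ ℓ N 𝕏) := by
    intro q hq
    simp only [hdet q hq.1, hΓ.abs_one_sub_dotProduct hN hq, e.apply_symm_apply]
  constructor
  · have h1 : IntegrableOn (fun y => g (e y)) (e ⁻¹' (𝕏 \ ambiguitySet Γ ℓ)) :=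
      ((he.integrable_comp_emb hemb).2 hg).integrableOn
    rw [← himage, integrableOn_image_iff_integrableOn_abs_det_fderiv_smul volume hDm hD' hinj]
      at h1
    exact h1.congr_fun hcongr hDm
  · have h1 : ∫ x, g x = ∫ x in 𝕏 \ ambiguitySet Γ ℓ, g x := by
      rw [← integral_indicator (h𝕏.diff hΓ.measurableSet_ambiguitySet)]
      refine integral_congr_ae ?_
      filter_upwards [measure_eq_zero_iff_ae_notMem.1
        (IsSmoothJordanCurve.volume_ambiguitySet (Γ := Γ) (ℓ := ℓ))] with x hx
      by_cases hx𝕏 : x ∈ 𝕏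
      · rw [indicator_of_mem (show x ∈ 𝕏 \ ambiguitySet Γ ℓ from ⟨hx𝕏, hx⟩)]
      · rw [hg0 x hx𝕏, indicator_of_notMem (s := 𝕏 \ ambiguitySet Γ ℓ) fun h => hx𝕏 h.1]
    rw [h1, ← he.setIntegral_preimage_emb hemb, ← himage,
      integral_image_eq_integral_abs_det_fderiv_smul volume hDm hD' hinj]
    exact setIntegral_congr_fun hDm hcongr

end ChangeOfVariables

/-! ### Disintegration of the bias and self-consistency -/

section SelfConsistency

variable {d : ℕ} {Γ : ℝ → E d} {ℓ : ℝ} {N : Fin (d - 1) → ℝ → E d} {p : E d → ℝ} {C ρ : ℝ}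
  {𝕏 : Set (E d)}

theorem IsSmoothJordanCurve.exists_measurable_eqOn (hΓ : IsSmoothJordanCurve Γ ℓ) :
    ∃ φ : ℝ → E d, Measurable φ ∧ ∀ s ∈ Icc 0 ℓ, φ s = Γ s := by
  classical
  exact ⟨(Icc 0 ℓ).piecewise Γ fun _ => 0,
    hΓ.continuousOn.measurable_piecewise continuousOn_const measurableSet_Icc,
    fun s hs => piecewise_eq_of_mem _ _ _ hs⟩

theorem IsSmoothJordanCurve.measurable_proj (hΓ : IsSmoothJordanCurve Γ ℓ) :
    Measurable (proj Γ ℓ) := by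
  obtain ⟨φ, hφ, hφΓ⟩ := hΓ.exists_measurable_eqOn
  have : proj Γ ℓ = fun x => φ (projIndex Γ ℓ x) :=
    funext fun x => (hφΓ _ (hΓ.projIndex_mem x)).symm
  rw [this]
  exact hφ.comp hΓ.measurable_projIndex

theorem IsBoundedAlong.integrable_smul_sub_proj (hp : IsBoundedAlong p Γ ℓ N C ρ)
    (hΓ : IsSmoothJordanCurve Γ ℓ) (h𝕏 : IsCompact 𝕏) (hp0 : ∀ x ∉ 𝕏, p x = 0)
    (hΓ𝕏 : MapsTo Γ (Icc 0 ℓ) 𝕏) :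
    Integrable fun x => p x • (x - proj Γ ℓ x) := by
  obtain ⟨r, hr⟩ := h𝕏.isBounded.exists_norm_le
  have hi : Integrable (𝕏.indicator fun _ : E d => C * (r + r)) := by
    rw [integrable_indicator_iff h𝕏.measurableSet]
    exact integrableOn_const h𝕏.measure_lt_top.ne
  refine hi.mono' ?_ (.of_forall fun x => ?_)
  · exact (hp.measurable.smul (measurable_id.sub hΓ.measurable_proj)).aestronglyMeasurable
  · by_cases hx : x ∈ 𝕏
    · rw [indicator_of_mem hx, norm_smul, Real.norm_of_nonneg (hp.nonneg x)]
      refine mul_le_mul (hp.le x) ?_ (norm_nonneg _) ((hp.nonneg x).trans (hp.le x))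
      exact (norm_sub_le _ _).trans
        (add_le_add (hr x hx) (hr _ (hΓ𝕏 (hΓ.projIndex_mem x))))
    · rw [indicator_of_notMem hx, hp0 x hx, zero_smul, norm_zero]

/-- The vector in the normal space at `s` with coordinates `μ(s) - G(s) κ(s)`. -/
noncomputable def defect (p : E d → ℝ) (Γ : ℝ → E d) (ℓ : ℝ) (N : Fin (d - 1) → ℝ → E d)
    (s : ℝ) : E d :=
  normalVec N s (momentVector p Γ ℓ N s -
    (gramMatrix p Γ ℓ N s).mulVec (principalCurvature Γ ℓ N s))

theorem IsNormalFrame.defect_eq_zero_iff (hN : IsNormalFrame Γ ℓ N) {s : ℝ} (hs : s ∈ Icc 0 ℓ) :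
    defect p Γ ℓ N s = 0 ↔ momentVector p Γ ℓ N s =
      (gramMatrix p Γ ℓ N s).mulVec (principalCurvature Γ ℓ N s) := by
  rw [← sub_eq_zero (a := momentVector p Γ ℓ N s), defect]
  constructor
  · intro h
    have := hN.norm_le_norm_normalVec hs (momentVector p Γ ℓ N s -
      (gramMatrix p Γ ℓ N s).mulVec (principalCurvature Γ ℓ N s))
    rw [h, norm_zero] at this
    exact norm_le_zero_iff.1 this
  · intro h
    rw [h]
    simp [normalVec]

/-- Expanding 1 - κ·u coordinatewise, the 1 produces first moments and κ·u produces second moments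
contracted with κ. -/
theorem IsBoundedAlong.integral_normalRegion (hp : IsBoundedAlong p Γ ℓ N C ρ)
    {s : ℝ} (hs : s ∈ Icc 0 ℓ) :
    ∫ u in normalRegion Γ ℓ N s, (1 - principalCurvature Γ ℓ N s ⬝ᵥ u) •
      p (normalMap Γ N (s, u)) • normalVec N s u = defect p Γ ℓ N s := by
  set κ := principalCurvature Γ ℓ N s with hκ
  have hf : ∀ i, Continuous fun u : Fin (d - 1) → ℝ => u i * (κ ⬝ᵥ u) := by
    intro i
    unfold dotProduct
    fun_prop
  have hi1 : ∀ i, IntegrableOn (fun u => u i * p (normalMap Γ N (s, u)))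
      (normalRegion Γ ℓ N s) := fun i =>
    (hp.integrable_mul (f := fun u => u i) (by fun_prop) hs).integrableOn
  have hi2 : ∀ i, IntegrableOn (fun u => (u i * (κ ⬝ᵥ u)) * p (normalMap Γ N (s, u)))
      (normalRegion Γ ℓ N s) := fun i => (hp.integrable_mul (hf i) hs).integrableOn
  have h : ∀ u : Fin (d - 1) → ℝ, (1 - κ ⬝ᵥ u) • p (normalMap Γ N (s, u)) • normalVec N s u =
      ∑ i, (u i * p (normalMap Γ N (s, u)) -
        (u i * (κ ⬝ᵥ u)) * p (normalMap Γ N (s, u))) • N i s := by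
    intro u
    simp only [normalVec, Finset.smul_sum, smul_smul]
    exact Finset.sum_congr rfl fun i _ => by congr 1; ring
  simp only [h]
  rw [integral_finsetSum _ fun i _ => ((hi1 i).fun_sub (hi2 i)).smul_const _, defect, normalVec]
  refine Finset.sum_congr rfl fun i _ => ?_
  rw [integral_smul_const, integral_sub (hi1 i) (hi2 i), Pi.sub_apply, momentVector_apply,
    hp.gramMatrix_mulVec hs]

/-- Disintegration of the conditional bias along the curve. -/
theorem IsBoundedAlong.setIntegral_preimage_projIndex (hd : 1 ≤ d)
    (hp : IsBoundedAlong p Γ ℓ N C ρ) (hΓ : IsSmoothJordanCurve Γ ℓ) (hN : IsNormalFrame Γ ℓ N)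
    (h𝕏 : IsCompact 𝕏) (hp0 : ∀ x ∉ 𝕏, p x = 0) (hΓ𝕏 : MapsTo Γ (Icc 0 ℓ) 𝕏)
    (hν : IsNormalDiffeo Γ ℓ N 𝕏) {B : Set ℝ} (hB : MeasurableSet B) :
    IntegrableOn (defect p Γ ℓ N) (Icc 0 ℓ ∩ B) ∧
      ∫ x in projIndex Γ ℓ ⁻¹' B, p x • (x - proj Γ ℓ x) =
        ∫ s in Icc 0 ℓ ∩ B, defect p Γ ℓ N s := by
  have hBm := hΓ.measurable_projIndex hB
  have hDm := hΓ.measurableSet_normalDomain hN h𝕏.measurableSet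
  set g : E d → E d := (projIndex Γ ℓ ⁻¹' B).indicator fun x => p x • (x - proj Γ ℓ x) with hg
  have hgi : Integrable g := (hp.integrable_smul_sub_proj hΓ h𝕏 hp0 hΓ𝕏).indicator hBm
  have hg0 : ∀ x ∉ 𝕏, g x = 0 := by
    intro x hx
    rw [hg, indicator_apply_eq_zero]
    intro _
    rw [hp0 x hx, zero_smul]
  obtain ⟨h1, h2⟩ := hΓ.integral_eq_integral_normalDomain hd hN h𝕏.measurableSet hν hgi hg0
  rw [← integrable_indicator_iff hDm, Measure.volume_eq_prod] at h1
  rw [← integral_indicator hDm, Measure.volume_eq_prod, integral_prod _ h1, hg,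
    integral_indicator hBm] at h2
  have h3 : ∀ s, (∫ u, (normalDomain Γ ℓ N 𝕏).indicator (fun q =>
      (1 - principalCurvature Γ ℓ N q.1 ⬝ᵥ q.2) • g (normalMap Γ N q)) (s, u)) =
      (Icc 0 ℓ ∩ B).indicator (defect p Γ ℓ N) s := by
    intro s
    by_cases hs : s ∈ Icc 0 ℓ
    · have h4 : ∀ u, (normalDomain Γ ℓ N 𝕏).indicator (fun q =>
          (1 - principalCurvature Γ ℓ N q.1 ⬝ᵥ q.2) • g (normalMap Γ N q)) (s, u) =
          (normalRegion Γ ℓ N s).indicator (fun u =>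
            (1 - principalCurvature Γ ℓ N s ⬝ᵥ u) • g (normalMap Γ N (s, u))) u := by
        intro u
        by_cases hu : u ∈ normalRegion Γ ℓ N s
        · rw [indicator_of_mem hu]
          by_cases hx : normalMap Γ N (s, u) ∈ 𝕏
          · rw [indicator_of_mem (show (s, u) ∈ normalDomain Γ ℓ N 𝕏 from ⟨hs, hu, hx⟩)]
          · rw [indicator_of_notMem (fun h => hx h.2.2), hg0 _ hx, smul_zero]
        · rw [indicator_of_notMem hu, indicator_of_notMem (fun h => hu h.2.1)]
      simp only [h4]
      rw [integral_indicator (hΓ.measurableSet_normalRegion s)]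
      by_cases hsB : s ∈ B
      · rw [indicator_of_mem (show s ∈ Icc 0 ℓ ∩ B from ⟨hs, hsB⟩),
          ← hp.integral_normalRegion hs]
        refine setIntegral_congr_fun (hΓ.measurableSet_normalRegion s) fun u hu => ?_
        -- The whole slice projects to s, so the indicator of λ⁻¹(B) is constant on it.
        have h5 : normalMap Γ N (s, u) ∈ projIndex Γ ℓ ⁻¹' B := by
          rw [mem_preimage, hu.1]
          exact hsB
        simp only [hg]
        rw [indicator_of_mem h5, proj, hu.1]
        simp only [normalMap_eq, add_sub_cancel_left]
      · rw [indicator_of_notMem (fun h => hsB h.2)]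
        refine setIntegral_eq_zero_of_forall_eq_zero fun u hu => ?_
        have h5 : normalMap Γ N (s, u) ∉ projIndex Γ ℓ ⁻¹' B := by
          rw [mem_preimage, hu.1]
          exact hsB
        rw [hg, indicator_of_notMem h5, smul_zero]
    · rw [indicator_of_notMem (fun h => hs h.1)]
      refine integral_eq_zero_of_ae (.of_forall fun u => ?_)
      exact indicator_of_notMem (fun h => hs h.1) _
  have hm : MeasurableSet (Icc 0 ℓ ∩ B) := measurableSet_Icc.inter hB
  have h6 := h1.integral_prod_left
  simp only [h3] at h6
  simp only [← hg, h3] at h2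
  refine ⟨(integrable_indicator_iff hm).1 h6, ?_⟩
  rw [h2, integral_indicator hm]

theorem IsBoundedAlong.forall_setIntegral_eq_zero_iff (hd : 1 ≤ d)
    (hp : IsBoundedAlong p Γ ℓ N C ρ) (hΓ : IsSmoothJordanCurve Γ ℓ) (hN : IsNormalFrame Γ ℓ N)
    (h𝕏 : IsCompact 𝕏) (hp0 : ∀ x ∉ 𝕏, p x = 0) (hΓ𝕏 : MapsTo Γ (Icc 0 ℓ) 𝕏)
    (hν : IsNormalDiffeo Γ ℓ N 𝕏) :
    (∀ B : Set ℝ, MeasurableSet B →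
      ∫ x in projIndex Γ ℓ ⁻¹' B, p x • (x - proj Γ ℓ x) = 0) ↔
      ∀ᵐ s ∂(volume.restrict (Icc 0 ℓ)), momentVector p Γ ℓ N s =
        (gramMatrix p Γ ℓ N s).mulVec (principalCurvature Γ ℓ N s) := by
  have key := fun (B : Set ℝ) (hB : MeasurableSet B) =>
    hp.setIntegral_preimage_projIndex hd hΓ hN h𝕏 hp0 hΓ𝕏 hν hB
  have hiff : (∀ᵐ s ∂(volume.restrict (Icc 0 ℓ)), momentVector p Γ ℓ N s =
      (gramMatrix p Γ ℓ N s).mulVec (principalCurvature Γ ℓ N s)) ↔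
      defect p Γ ℓ N =ᵐ[volume.restrict (Icc 0 ℓ)] 0 := by
    refine Filter.eventually_congr ?_
    filter_upwards [ae_restrict_mem measurableSet_Icc] with s hs
    exact (hN.defect_eq_zero_iff hs).symm
  rw [hiff]
  constructor
  · intro h
    have hi : Integrable (defect p Γ ℓ N) (volume.restrict (Icc 0 ℓ)) := by
      have := (key univ .univ).1
      rwa [inter_univ] at this
    refine hi.ae_eq_zero_of_forall_setIntegral_eq_zero fun B hB _ => ?_
    rw [Measure.restrict_restrict hB, inter_comm, ← (key B hB).2]
    exact h B hB
  · intro h B hB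
    rw [(key B hB).2, inter_comm, ← Measure.restrict_restrict hB]
    exact integral_eq_zero_of_ae (ae_restrict_of_ae h)

variable {Ω : Type*} [MeasurableSpace Ω] {P : Measure Ω} [IsProbabilityMeasure P] {X : Ω → E d}

/-- Self-consistency means that the conditional bias integrates to zero over every Borel set of
parameters. -/
theorem isSelfConsistent_iff_forall_setIntegral (hp_meas : Measurable p) (hp : ∀ x, 0 ≤ p x)
    (hX : Measurable X) (hX_law : P.map X = volume.withDensity fun x => ENNReal.ofReal (p x))
    (hΓ : IsSmoothJordanCurve Γ ℓ) (h𝕏 : IsCompact 𝕏) (hp0 : ∀ x ∉ 𝕏, p x = 0)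
    (hΓ𝕏 : MapsTo Γ (Icc 0 ℓ) 𝕏) :
    IsSelfConsistent P X Γ ℓ ↔ ∀ B : Set ℝ, MeasurableSet B →
      ∫ x in projIndex Γ ℓ ⁻¹' B, p x • (x - proj Γ ℓ x) = 0 := by
  obtain ⟨r, hr⟩ := h𝕏.isBounded.exists_norm_le
  obtain ⟨φ, hφ, hφΓ⟩ := hΓ.exists_measurable_eqOn
  set Y : Ω → ℝ := fun w => projIndex Γ ℓ (X w) with hYdef
  have hY : Measurable Y := hΓ.measurable_projIndex.comp hX
  have hYI : ∀ w, Y w ∈ Icc 0 ℓ := fun w => hΓ.projIndex_mem _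
  have hX𝕏 : ∀ᵐ w ∂P, X w ∈ 𝕏 := by
    have h1 : ∀ᵐ x ∂(P.map X), x ∈ 𝕏 := by
      rw [hX_law, ae_iff]
      change (volume.withDensity _) 𝕏ᶜ = 0
      rw [withDensity_apply _ h𝕏.measurableSet.compl]
      refine (setLIntegral_congr_fun h𝕏.measurableSet.compl fun x hx => ?_).trans lintegral_zero
      simp [hp0 x hx]
    exact ae_of_ae_map hX.aemeasurable h1
  have hXi : Integrable X P := by
    refine (integrable_const r).mono' hX.aestronglyMeasurable ?_
    filter_upwards [hX𝕏] with w hw using hr _ hw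
  have hφi : Integrable (φ ∘ Y) P := by
    refine (integrable_const r).mono' (hφ.comp hY).aestronglyMeasurable (.of_forall fun w => ?_)
    rw [Function.comp_apply, hφΓ _ (hYI w)]
    exact hr _ (hΓ𝕏 (hYI w))
  -- The sets Y ⁻¹' B exhaust σ(Y), so these differences are exactly those tested in the definition
  -- of conditional expectation.
  have hkey : ∀ B : Set ℝ, MeasurableSet B →
      ∫ x in projIndex Γ ℓ ⁻¹' B, p x • (x - proj Γ ℓ x) =
        (∫ w in Y ⁻¹' B, X w ∂P) - ∫ w in Y ⁻¹' B, (φ ∘ Y) w ∂P := by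
    intro B hB
    have hBm := hΓ.measurable_projIndex hB
    rw [← integral_sub hXi.integrableOn hφi.integrableOn]
    have h1 : ∀ w, X w - (φ ∘ Y) w = X w - proj Γ ℓ (X w) := fun w => by
      rw [Function.comp_apply, hφΓ _ (hYI w)]; rfl
    simp only [h1]
    have h2 := setIntegral_map (μ := P) (g := X) (f := fun x => x - proj Γ ℓ x) hBm
      (measurable_id.sub hΓ.measurable_proj).aestronglyMeasurable hX.aemeasurable
    refine Eq.trans ?_ h2
    rw [hX_law, restrict_withDensity hBm, integral_withDensity_eq_integral_toReal_smul
      (by fun_prop) (by simp)]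
    simp only [ENNReal.toReal_ofReal (hp _)]
  have hae : ∀ᵐ s ∂(P.map Y), φ s = Γ s := by
    have : ∀ᵐ s ∂(P.map Y), s ∈ Icc 0 ℓ :=
      (ae_map_iff hY.aemeasurable measurableSet_Icc).2 (.of_forall hYI)
    filter_upwards [this] with s hs using hφΓ s hs
  constructor
  · rintro ⟨ψ, ⟨-, hψ⟩, hψΓ⟩ B hB
    have h1 : P[X | MeasurableSpace.comap Y inferInstance] =ᵐ[P] φ ∘ Y := by
      filter_upwards [hψ, ae_of_ae_map hY.aemeasurable hψΓ] with w h1 h2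
      rw [h1, Function.comp_apply, Function.comp_apply, h2, hφΓ _ (hYI w)]
    rw [hkey B hB, sub_eq_zero, ← setIntegral_condExp hY.comap_le hXi ⟨B, hB, rfl⟩]
    exact integral_congr_ae (ae_restrict_of_ae h1)
  · intro h
    -- The version is a Borel extension of Γ from [0, ℓ], because Γ itself need not be measurable on
    -- ℝ.
    refine ⟨φ, ⟨hφ, ?_⟩, hae⟩
    refine (ae_eq_condExp_of_forall_setIntegral_eq hY.comap_le hXi
      (fun _ _ _ => hφi.integrableOn) ?_ ?_).symm
    · rintro _ ⟨B, hB, rfl⟩ -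
      exact (sub_eq_zero.1 ((hkey B hB).symm.trans (h B hB))).symm
    · exact (hφ.comp (comap_measurable Y)).aestronglyMeasurable

end SelfConsistency

end PrincipalCurve

/-! ### The main theorem -/

theorem mainTheorem1 {Ω : Type*} [MeasurableSpace Ω] (P : Measure Ω) [IsProbabilityMeasure P]
    {d : ℕ} (hd : 2 ≤ d)
    -- the random vector, its density `p` and the compact support `𝕏` of `p`
    (X : Ω → PrincipalCurve.E d) (hX : Measurable X)
    (p : PrincipalCurve.E d → ℝ) (𝕏 : Set (PrincipalCurve.E d))
    (hp_nonneg : ∀ x, 0 ≤ p x)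
    (hX_law : P.map X = volume.withDensity fun x => ENNReal.ofReal (p x))
    (hp_supp : tsupport p = 𝕏) (h𝕏 : IsCompact 𝕏)
    (hp_smooth : ContDiffOn ℝ ∞ p 𝕏)
    (hp_pos : ∀ x ∈ interior 𝕏, 0 < p x)
    -- the curve in `𝕏` and a moving frame along it
    (Γ : ℝ → PrincipalCurve.E d) (ℓ : ℝ) (hΓ : PrincipalCurve.IsSmoothJordanCurve Γ ℓ)
    (hΓ𝕏 : MapsTo Γ (Icc 0 ℓ) 𝕏)
    (N : Fin (d - 1) → ℝ → PrincipalCurve.E d) (hN : PrincipalCurve.IsNormalFrame Γ ℓ N)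
    (hν : PrincipalCurve.IsNormalDiffeo Γ ℓ N 𝕏) :
    -- density continuous on the whole space: the linear system holds at every parameter
    (Continuous p →
      (PrincipalCurve.IsSelfConsistent P X Γ ℓ ↔
        ∀ s ∈ Icc 0 ℓ, PrincipalCurve.momentVector p Γ ℓ N s =
          (PrincipalCurve.gramMatrix p Γ ℓ N s).mulVec
            (PrincipalCurve.principalCurvature Γ ℓ N s))) ∧
    -- density possibly jumping to zero across the boundary of its support
    (PrincipalCurve.IsSelfConsistent P X Γ ℓ ↔
      ∀ᵐ s ∂(volume.restrict (Icc 0 ℓ)), PrincipalCurve.momentVector p Γ ℓ N s =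
        (PrincipalCurve.gramMatrix p Γ ℓ N s).mulVec
          (PrincipalCurve.principalCurvature Γ ℓ N s)) ∧
    -- invertibility of the Gram matrix
    (∀ s ∈ Icc 0 ℓ,
      (Γ s ∈ interior 𝕏 ∨ PrincipalCurve.transverseMoment p Γ ℓ N 0 s ≠ 0) →
        IsUnit (PrincipalCurve.gramMatrix p Γ ℓ N s)) ∧
    -- the solved form of the system
    (Continuous p →
      (PrincipalCurve.IsSelfConsistent P X Γ ℓ ↔
        ∀ s ∈ Icc 0 ℓ, PrincipalCurve.transverseMoment p Γ ℓ N 0 s ≠ 0 →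
          PrincipalCurve.principalCurvature Γ ℓ N s =
            (PrincipalCurve.gramMatrix p Γ ℓ N s)⁻¹.mulVec
              (PrincipalCurve.momentVector p Γ ℓ N s))) ∧
    (PrincipalCurve.IsSelfConsistent P X Γ ℓ ↔
      ∀ᵐ s ∂(volume.restrict (Icc 0 ℓ)), PrincipalCurve.transverseMoment p Γ ℓ N 0 s ≠ 0 →
        PrincipalCurve.principalCurvature Γ ℓ N s =
          (PrincipalCurve.gramMatrix p Γ ℓ N s)⁻¹.mulVec
            (PrincipalCurve.momentVector p Γ ℓ N s)) := by
  have hp0 : ∀ x ∉ 𝕏, p x = 0 := fun x hx => image_eq_zero_of_notMem_tsupport (hp_supp ▸ hx)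
  obtain ⟨C, ρ, hp⟩ := PrincipalCurve.exists_isBoundedAlong hp_nonneg hp_supp h𝕏
    hp_smooth.continuousOn hΓ𝕏 hN
  have hunit : ∀ s ∈ Icc 0 ℓ,
      (Γ s ∈ interior 𝕏 ∨ PrincipalCurve.transverseMoment p Γ ℓ N 0 s ≠ 0) →
        IsUnit (PrincipalCurve.gramMatrix p Γ ℓ N s) :=
    fun s hs => hp.isUnit_gramMatrix hΓ hN hp_pos hs
  have hae : PrincipalCurve.IsSelfConsistent P X Γ ℓ ↔
      ∀ᵐ s ∂(volume.restrict (Icc 0 ℓ)), PrincipalCurve.momentVector p Γ ℓ N s =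
        (PrincipalCurve.gramMatrix p Γ ℓ N s).mulVec
          (PrincipalCurve.principalCurvature Γ ℓ N s) :=
    (PrincipalCurve.isSelfConsistent_iff_forall_setIntegral hp.measurable hp_nonneg hX hX_law hΓ
      h𝕏 hp0 hΓ𝕏).trans
      (hp.forall_setIntegral_eq_zero_iff (by omega) hΓ hN h𝕏 hp0 hΓ𝕏 hν)
  have hall : Continuous p → (PrincipalCurve.IsSelfConsistent P X Γ ℓ ↔
      ∀ s ∈ Icc 0 ℓ, PrincipalCurve.momentVector p Γ ℓ N s =
        (PrincipalCurve.gramMatrix p Γ ℓ N s).mulVec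
          (PrincipalCurve.principalCurvature Γ ℓ N s)) := fun hpc =>
    hae.trans (PrincipalCurve.eqOn_Icc_of_ae_eq hΓ.length_pos
      (hp.continuousOn_momentVector hΓ hN hpc) (hp.continuousOn_gramMatrix_mulVec hΓ hN hpc))
  -- The two forms of the system agree at each single s: with mass G(s) is invertible, without mass
  -- both conditions are void. Hence it serves both the everywhere and the almost everywhere
  -- versions.
  have hsolve : ∀ s ∈ Icc 0 ℓ, (PrincipalCurve.momentVector p Γ ℓ N s =
      (PrincipalCurve.gramMatrix p Γ ℓ N s).mulVec (PrincipalCurve.principalCurvature Γ ℓ N s) ↔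
      (PrincipalCurve.transverseMoment p Γ ℓ N 0 s ≠ 0 →
        PrincipalCurve.principalCurvature Γ ℓ N s =
          (PrincipalCurve.gramMatrix p Γ ℓ N s)⁻¹.mulVec
            (PrincipalCurve.momentVector p Γ ℓ N s))) := by
    intro s hs
    constructor
    · intro h h0
      have hu := (Matrix.isUnit_iff_isUnit_det _).1 (hunit s hs (Or.inr h0))
      rw [h, Matrix.mulVec_mulVec, Matrix.nonsing_inv_mul _ hu, Matrix.one_mulVec]
    · intro h
      by_cases h0 : PrincipalCurve.transverseMoment p Γ ℓ N 0 s = 0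
      · exact hp.moment_eq_of_transverseMoment_zero hs h0 _
      · have hu := (Matrix.isUnit_iff_isUnit_det _).1 (hunit s hs (Or.inr h0))
        rw [h h0, Matrix.mulVec_mulVec, Matrix.mul_nonsing_inv _ hu, Matrix.one_mulVec]
  refine ⟨hall, hae, hunit, fun hpc => (hall hpc).trans (forall₂_congr hsolve), hae.trans ?_⟩
  refine Filter.eventually_congr ?_
  filter_upwards [ae_restrict_mem measurableSet_Icc] with s hs using hsolve s hs
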